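/- Let $b_1,b_2>0$ and write $(\Delta_d w)(j)=w(j+1)-2w(j)+w(j-1)$. Sequences are complex valued. Consider, for $u=(u(t,j))_{j\le 0}$ and $v=(v(t,j))_{j\ge 0}$, the system $$\left\{\begin{array}{ll} i u_t(t,j)+b_1^{-2}(\Delta_d u)(t,j)=0, & j\le -1,\ t\ne 0,\\ i v_t(t,j)+b_2^{-2}(\Delta_d v)(t,j)=0, & j\ge 1,\ t\ne 0,\\ u(t,0)=v(t,0), & t\ne 0,\\ b_1^{-2}\big(u(t,-1)-u(t,0)\big)=b_2^{-2}\big(v(t,0)-v(t,1)\big), & t\ne 0,\\ u(0,j)=\varphi(j), & j\le -1,\\ v(0,j)=\varphi(j), & j\ge 1, \end{array}\right.$$ where $u(t,0)$ and $v(t,0)$ are auxiliary values that couple the two equations, and $(u,v)(t)$ denotes the sequence on $\mathbb{Z}\setminus\{0\}$ equal to $u(t,j)$ for $j\le -1$ and to $v(t,j)$ for $j\ge 1$. For any $\varphi\in l^2(\mathbb{Z}\setminus\{0\})$ there exists a unique solution $(u,v)\in C(\mathbb{R},l^2(\mathbb{Z}\setminus\{0\}))$ of this system. Moreover, there exists a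 positive constant $C(b_1,b_2)$, depending only on $b_1$ and $b_2$, such that $$\|(u,v)(t)\|_{l^\infty(\mathbb{Z}\setminus\{0\})}\le C(b_1,b_2)(|t|+1)^{-1/3}\|\varphi\|_{l^1(\mathbb{Z}\setminus\{0\})},\qquad \forall\, t\in\mathbb{R},$$ holds for all $\varphi\in l^1(\mathbb{Z}\setminus\{0\})$, where $(u,v)$ is the solution with datum $\varphi$. -/

import Mathlib

open scoped ENNReal

/-- The index set `ℤ \ {0}`. -/
abbrev ZStar : Type := {j : ℤ // j ≠ 0}

/-- The complex sequence space `l^p(ℤ \ {0})`. -/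
abbrev SeqSpace (p : ℝ≥0∞) : Type := lp (fun _ : ZStar => ℂ) p

/-- The inclusion `l^p ⊆ l^q` for `p ≤ q`, as a map between the two normed spaces. -/
def SeqSpace.incl {p q : ℝ≥0∞} (h : p ≤ q) (f : SeqSpace p) : SeqSpace q :=
  ⟨fun j => f j, (lp.memℓp f).of_exponent_ge h⟩

/-- The discrete Laplacian `(Δ_d w)(j) = w(j+1) - 2 w(j) + w(j-1)`. -/
def discreteLaplacian (w : ℤ → ℂ) (j : ℤ) : ℂ :=
  w (j + 1) - 2 * w j + w (j - 1)

/-- The sequence on `ℤ` that agrees with `f` off `0` and takes the value `a` at `0`. -/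
def extendAtZero (f : ZStar → ℂ) (a : ℂ) : ℤ → ℂ :=
  fun j => if h : j = 0 then a else f ⟨j, h⟩

/-- `U = (u, v)` solves the coupled system with initial datum `φ`. Here `u(t, j) = U(t)(j)` for
`j ≤ -1` and `v(t, j) = U(t)(j)` for `j ≥ 1`; the functions `u₀`, `v₀` are the values `u(t, 0)`,
`v(t, 0)` that are introduced at the interface in order to couple the two equations. -/
def IsCoupledSolution (b₁ b₂ : ℝ) (φ : SeqSpace 2) (U : ℝ → SeqSpace 2) : Prop :=
  ∃ u₀ v₀ : ℝ → ℂ,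
    (∀ t : ℝ, t ≠ 0 → ∀ j : ZStar, j.1 ≤ -1 →
      DifferentiableAt ℝ (fun s : ℝ => U s j) t ∧
      Complex.I * deriv (fun s : ℝ => U s j) t
        + ((b₁ ^ 2)⁻¹ : ℂ) * discreteLaplacian (extendAtZero (fun k => U t k) (u₀ t)) j.1 = 0) ∧
    (∀ t : ℝ, t ≠ 0 → ∀ j : ZStar, 1 ≤ j.1 →
      DifferentiableAt ℝ (fun s : ℝ => U s j) t ∧
      Complex.I * deriv (fun s : ℝ => U s j) t
        + ((b₂ ^ 2)⁻¹ : ℂ) * discreteLaplacian (extendAtZero (fun k => U t k) (v₀ t)) j.1 = 0) ∧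
    (∀ t : ℝ, t ≠ 0 → u₀ t = v₀ t) ∧
    (∀ t : ℝ, t ≠ 0 →
      ((b₁ ^ 2)⁻¹ : ℂ) * (U t ⟨-1, by decide⟩ - u₀ t)
        = ((b₂ ^ 2)⁻¹ : ℂ) * (v₀ t - U t ⟨1, by decide⟩)) ∧
    (∀ j : ZStar, U 0 j = φ j)

/-- The common value at the node `0` forced by the flux condition. -/
noncomputable def interfaceValue (α β : ℝ) (f : ZStar → ℂ) : ℂ :=
  (α * f ⟨-1, by decide⟩ + β * f ⟨1, by decide⟩) / (α + β)

/-- The operator obtained from the coupled system by eliminating the node `0`. -/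
noncomputable def coupledLaplacian (α β : ℝ) (f : ZStar → ℂ) (j : ZStar) : ℂ :=
  (if j.1 < 0 then (α : ℂ) else β) * discreteLaplacian (extendAtZero f (interfaceValue α β f)) j.1

theorem norm_interfaceValue_le {α β : ℝ} (hα : 0 < α) (hβ : 0 < β) {f : ZStar → ℂ} {B : ℝ}
    (hf : ∀ j, ‖f j‖ ≤ B) : ‖interfaceValue α β f‖ ≤ B := by
  have h0 : ‖(α + β : ℂ)‖ = α + β := by
    rw [← Complex.ofReal_add, Complex.norm_real, Real.norm_of_nonneg (by positivity)]
  rw [interfaceValue, norm_div, h0, div_le_iff₀ (by positivity)]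
  refine (norm_add_le _ _).trans ?_
  rw [norm_mul, norm_mul, Complex.norm_real, Complex.norm_real, Real.norm_of_nonneg hα.le,
    Real.norm_of_nonneg hβ.le]
  have h1 := mul_le_mul_of_nonneg_left (hf ⟨-1, by decide⟩) hα.le
  have h2 := mul_le_mul_of_nonneg_left (hf ⟨1, by decide⟩) hβ.le
  linarith

theorem norm_coupledLaplacian_le {α β : ℝ} (hα : 0 < α) (hβ : 0 < β) {f : ZStar → ℂ} {B : ℝ}
    (hf : ∀ j, ‖f j‖ ≤ B) (j : ZStar) :
    ‖coupledLaplacian α β f j‖ ≤ (4 * (α + β)) * B := by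
  have hB : 0 ≤ B := (norm_nonneg _).trans (hf j)
  have hE : ∀ k, ‖extendAtZero f (interfaceValue α β f) k‖ ≤ B := fun k => by
    unfold extendAtZero
    split_ifs
    · exact norm_interfaceValue_le hα hβ hf
    · exact hf _
  have hc : ‖(if j.1 < 0 then (α : ℂ) else β)‖ ≤ α + β := by
    split_ifs <;> rw [Complex.norm_real, Real.norm_of_nonneg (by positivity)] <;> linarith
  have hd : ‖discreteLaplacian (extendAtZero f (interfaceValue α β f)) j.1‖ ≤ 4 * B := by
    unfold discreteLaplacian
    refine (norm_add_le _ _).trans ?_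
    refine (add_le_add_left (norm_sub_le _ _) _).trans ?_
    rw [norm_mul, Complex.norm_two]
    linarith [hE (j.1 + 1), hE j.1, hE (j.1 - 1)]
  rw [coupledLaplacian, norm_mul]
  calc _ ≤ (α + β) * (4 * B) := by gcongr
    _ = _ := by ring

theorem coupledLaplacian_sub (α β : ℝ) (f g : ZStar → ℂ) (j : ZStar) :
    coupledLaplacian α β (fun k => f k - g k) j
      = coupledLaplacian α β f j - coupledLaplacian α β g j := by
  have hE : ∀ k, extendAtZero (fun k => f k - g k) (interfaceValue α β (fun k => f k - g k)) k
      = extendAtZero f (interfaceValue α β f) k - extendAtZero g (interfaceValue α β g) k := by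
    intro k
    unfold extendAtZero interfaceValue
    split_ifs <;> ring
  simp only [coupledLaplacian, discreteLaplacian, hE]
  ring

theorem continuous_coupledLaplacian (α β : ℝ) {U : ℝ → ZStar → ℂ}
    (hU : ∀ j, Continuous fun t => U t j) (j : ZStar) :
    Continuous fun t => coupledLaplacian α β (U t) j := by
  have hE : ∀ k, Continuous fun t => extendAtZero (U t) (interfaceValue α β (U t)) k := by
    intro k
    unfold extendAtZero interfaceValue
    split_ifs <;> fun_prop
  have h1 := hE (j.1 + 1)
  have h2 := hE (j.1 - 1)
  have h3 := hE j.1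
  unfold coupledLaplacian discreteLaplacian
  fun_prop

theorem isCoupledSolution_iff {b₁ b₂ : ℝ} (hb₁ : 0 < b₁) (hb₂ : 0 < b₂) (φ : SeqSpace 2)
    {U : ℝ → SeqSpace 2} (hU : ∀ j, Continuous fun t => U t j) :
    IsCoupledSolution b₁ b₂ φ U ↔
      (∀ t j, HasDerivAt (fun s => U s j)
        (Complex.I * coupledLaplacian (b₁ ^ 2)⁻¹ (b₂ ^ 2)⁻¹ (U t) j) t) ∧ ∀ j, U 0 j = φ j := by
  have hb₁' : (b₁ : ℂ) ≠ 0 := by exact_mod_cast hb₁.ne'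
  have hb₂' : (b₂ : ℂ) ≠ 0 := by exact_mod_cast hb₂.ne'
  have hs : ((b₁ : ℂ) ^ 2)⁻¹ + ((b₂ : ℂ) ^ 2)⁻¹ ≠ 0 := by
    have : (b₁ ^ 2)⁻¹ + (b₂ ^ 2)⁻¹ ≠ 0 := by positivity
    exact_mod_cast this
  have hI := Complex.I_mul_I
  constructor
  · rintro ⟨u₀, v₀, hu, hv, huv, hfl, h0⟩
    refine ⟨?_, h0⟩
    intro t j
    refine hasDerivAt_of_hasDerivAt_of_ne' (x := (0 : ℝ)) ?_ (hU j).continuousAt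
      ((continuous_coupledLaplacian _ _ hU j).const_mul Complex.I).continuousAt t
    intro s hs0
    have ha : v₀ s = interfaceValue (b₁ ^ 2)⁻¹ (b₂ ^ 2)⁻¹ (U s) := by
      have h1 := hfl s hs0
      rw [huv s hs0] at h1
      rw [interfaceValue]
      push_cast
      rw [eq_div_iff hs]
      linear_combination -h1
    have ha' := (huv s hs0).trans ha
    rcases lt_or_gt_of_ne j.2 with hj | hj
    · obtain ⟨hd, he⟩ := hu s hs0 j (by omega)
      convert hd.hasDerivAt using 1
      rw [coupledLaplacian, if_pos hj, ← ha']
      push_cast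
      linear_combination Complex.I * he - deriv (fun s => U s j) s * hI
    · obtain ⟨hd, he⟩ := hv s hs0 j (by omega)
      convert hd.hasDerivAt using 1
      rw [coupledLaplacian, if_neg (by omega), ← ha]
      push_cast
      linear_combination Complex.I * he - deriv (fun s => U s j) s * hI
  · rintro ⟨hd, h0⟩
    refine ⟨fun t => interfaceValue (b₁ ^ 2)⁻¹ (b₂ ^ 2)⁻¹ (U t),
      fun t => interfaceValue (b₁ ^ 2)⁻¹ (b₂ ^ 2)⁻¹ (U t), ?_, ?_, fun _ _ => rfl, ?_, h0⟩
    · intro t _ j hj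
      refine ⟨(hd t j).differentiableAt, ?_⟩
      rw [(hd t j).deriv, coupledLaplacian, if_pos (by omega)]
      push_cast
      linear_combination ((b₁ : ℂ) ^ 2)⁻¹ * discreteLaplacian (extendAtZero (U t)
        (interfaceValue (b₁ ^ 2)⁻¹ (b₂ ^ 2)⁻¹ (U t))) j.1 * hI
    · intro t _ j hj
      refine ⟨(hd t j).differentiableAt, ?_⟩
      rw [(hd t j).deriv, coupledLaplacian, if_neg (by omega)]
      push_cast
      linear_combination ((b₂ : ℂ) ^ 2)⁻¹ * discreteLaplacian (extendAtZero (U t)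
        (interfaceValue (b₁ ^ 2)⁻¹ (b₂ ^ 2)⁻¹ (U t))) j.1 * hI
    · intro t _
      simp only [interfaceValue]
      push_cast
      rw [sub_div' hs, div_sub' hs, mul_div_assoc', mul_div_assoc', div_left_inj' hs]
      ring

/-- Uniqueness for sup-bounded solutions of a linear equation, by Picard iteration. -/
theorem eq_zero_of_hasDerivAt_of_bounded {ι : Type*} {W W' : ℝ → ι → ℂ} {C T : ℝ}
    (hd : ∀ t j, HasDerivAt (fun s => W s j) (W' t j) t)
    (hW' : ∀ t B, (∀ j, ‖W t j‖ ≤ B) → ∀ j, ‖W' t j‖ ≤ C * B)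
    (h0 : ∀ j, W 0 j = 0) (hb : ∃ B, ∀ t ∈ Set.Icc 0 T, ∀ j, ‖W t j‖ ≤ B) :
    ∀ t ∈ Set.Icc 0 T, ∀ j, W t j = 0 := by
  obtain ⟨B, hB⟩ := hb
  have key : ∀ n : ℕ, ∀ t ∈ Set.Icc 0 T, ∀ j, ‖W t j‖ ≤ B * ((C * t) ^ n / n.factorial) := by
    intro n
    induction n with
    | zero => simpa using hB
    | succ n ih =>
      intro t ht j
      refine image_norm_le_of_norm_deriv_right_le_deriv_boundary (a := 0) (b := T)
        (f := fun s => W s j) (f' := fun s => W' s j)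
        (B := fun t => B * ((C * t) ^ (n + 1) / (n + 1).factorial))
        (B' := fun t => C * (B * ((C * t) ^ n / n.factorial)))
        (fun s _ => (hd s j).continuousAt.continuousWithinAt)
        (fun s _ => (hd s j).hasDerivWithinAt) ?_ ?_ ?_ ht
      · simp [h0]
      · intro x
        have h := ((((hasDerivAt_id x).const_mul C).pow (n + 1)).div_const
          ((n + 1).factorial : ℝ)).const_mul B
        refine h.congr_deriv ?_
        rw [Nat.factorial_succ]
        push_cast
        have : (n.factorial : ℝ) ≠ 0 := by positivity
        have : (n + 1 : ℝ) ≠ 0 := by positivity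
        simp only [id]
        field_simp
      · intro x hx
        exact hW' x _ (fun k => ih x ⟨hx.1, hx.2.le⟩ k) j
  intro t ht j
  have hlim : Filter.Tendsto (fun n : ℕ => B * ((C * t) ^ n / n.factorial)) Filter.atTop
      (nhds (B * 0)) := (FloorSemiring.tendsto_pow_div_factorial_atTop (C * t)).const_mul B
  rw [mul_zero] at hlim
  have := ge_of_tendsto' hlim fun n => key n t ht j
  exact norm_le_zero_iff.1 this

theorem eq_of_hasDerivAt_coupledLaplacian {α β : ℝ} (hα : 0 < α) (hβ : 0 < β)
    {U V : ℝ → ZStar → ℂ}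
    (hU : ∀ t j, HasDerivAt (fun s => U s j) (Complex.I * coupledLaplacian α β (U t) j) t)
    (hV : ∀ t j, HasDerivAt (fun s => V s j) (Complex.I * coupledLaplacian α β (V t) j) t)
    (h0 : ∀ j, U 0 j = V 0 j)
    (hUb : ∀ T, ∃ B, ∀ t ∈ Set.Icc (-T) T, ∀ j, ‖U t j‖ ≤ B)
    (hVb : ∀ T, ∃ B, ∀ t ∈ Set.Icc (-T) T, ∀ j, ‖V t j‖ ≤ B) (t : ℝ) (j : ZStar) :
    U t j = V t j := by
  obtain ⟨B₁, hB₁⟩ := hUb |t|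
  obtain ⟨B₂, hB₂⟩ := hVb |t|
  have hsub : ∀ s ∈ Set.Icc (-|t|) |t|, ∀ j, ‖U s j - V s j‖ ≤ B₁ + B₂ := fun s hs j =>
    (norm_sub_le _ _).trans (add_le_add (hB₁ s hs j) (hB₂ s hs j))
  have hd : ∀ s j, HasDerivAt (fun s => U s j - V s j)
      (Complex.I * coupledLaplacian α β (fun k => U s k - V s k) j) s := fun s j => by
    refine ((hU s j).sub (hV s j)).congr_deriv ?_
    rw [coupledLaplacian_sub]
    ring

  rcases le_total 0 t with ht | ht
  · rw [abs_of_nonneg ht] at hsub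
    have := eq_zero_of_hasDerivAt_of_bounded (T := t) (C := 4 * (α + β)) hd
      (fun s B hB k => by
        rw [norm_mul, Complex.norm_I, one_mul]
        exact norm_coupledLaplacian_le hα hβ hB k)
      (fun k => by simp [h0]) ⟨B₁ + B₂, fun s hs k => hsub s ⟨by linarith [hs.1], hs.2⟩ k⟩
      t ⟨ht, le_rfl⟩ j
    exact sub_eq_zero.1 this
  · rw [abs_of_nonpos ht] at hsub
    have hd' : ∀ s j, HasDerivAt (fun s => U (-s) j - V (-s) j)
        (-(Complex.I * coupledLaplacian α β (fun k => U (-s) k - V (-s) k) j)) s := fun s j => by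
      have h := (hd (-s) j).scomp s (hasDerivAt_neg s)
      simpa [Function.comp_def] using h
    have := eq_zero_of_hasDerivAt_of_bounded (T := -t) (C := 4 * (α + β)) hd'
      (fun s B hB k => by
        rw [norm_neg, norm_mul, Complex.norm_I, one_mul]
        exact norm_coupledLaplacian_le hα hβ hB k)
      (fun k => by simp [h0])
      ⟨B₁ + B₂, fun s hs k => hsub (-s) ⟨by linarith [hs.2], by linarith [hs.1]⟩ k⟩
      (-t) ⟨by linarith, le_rfl⟩ j
    rw [neg_neg] at this
    exact sub_eq_zero.1 this

/-- A bounded weight composed with an injective relabelling acts boundedly on `l²`. -/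
theorem exists_weighted_comp (c : ZStar → ℂ) (s : ZStar → ZStar) (hs : Function.Injective s)
    {C : ℝ} (hc : ∀ j, ‖c j‖ ≤ C) :
    ∃ T : SeqSpace 2 →L[ℂ] SeqSpace 2, ∀ f j, T f j = c j * f (s j) := by
  have hC : 0 ≤ C := (norm_nonneg _).trans (hc ⟨1, by decide⟩)
  have h2 : (0 : ℝ) < (2 : ℝ≥0∞).toReal := by simp
  have hsum : ∀ f : SeqSpace 2, Summable fun j => ‖f j‖ ^ (2 : ℝ≥0∞).toReal := fun f =>
    (lp.memℓp f).summable h2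
  have hle : ∀ (f : SeqSpace 2) j, ‖c j * f (s j)‖ ^ (2 : ℝ≥0∞).toReal
      ≤ C ^ (2 : ℝ≥0∞).toReal * ‖f (s j)‖ ^ (2 : ℝ≥0∞).toReal := fun f j => by
    rw [norm_mul, Real.mul_rpow (norm_nonneg _) (norm_nonneg _)]
    gcongr
    exact hc j
  have hsum' : ∀ f : SeqSpace 2, Summable fun j =>
      C ^ (2 : ℝ≥0∞).toReal * ‖f (s j)‖ ^ (2 : ℝ≥0∞).toReal := fun f =>
    ((hsum f).comp_injective hs).mul_left _
  have hmem : ∀ f : SeqSpace 2, Memℓp (fun j => c j * f (s j)) 2 := fun f =>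
    memℓp_gen (Summable.of_nonneg_of_le (fun j => by positivity) (hle f) (hsum' f))
  let L : SeqSpace 2 →ₗ[ℂ] SeqSpace 2 :=
    { toFun := fun f => ⟨fun j => c j * f (s j), hmem f⟩
      map_add' := fun f g => lp.ext (funext fun j => mul_add _ _ _)
      map_smul' := fun a f => lp.ext (funext fun j => mul_left_comm _ _ _) }
  refine ⟨L.mkContinuous C fun f => ?_, fun f j => rfl⟩
  refine lp.norm_le_of_tsum_le h2 (by positivity) ?_
  rw [Real.mul_rpow hC (norm_nonneg _), lp.norm_rpow_eq_tsum h2 f]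
  calc _ ≤ ∑' j, C ^ (2 : ℝ≥0∞).toReal * ‖f (s j)‖ ^ (2 : ℝ≥0∞).toReal :=
        Summable.tsum_le_tsum (hle f) ((lp.memℓp (L f)).summable h2) (hsum' f)
    _ = C ^ (2 : ℝ≥0∞).toReal * ∑' j, ‖f (s j)‖ ^ (2 : ℝ≥0∞).toReal := tsum_mul_left
    _ ≤ _ := by
        exact mul_le_mul_of_nonneg_left
          (tsum_comp_le_tsum_of_inj (hsum f) (fun j => by positivity) hs) (by positivity)

/-- The right neighbour in `ℤ \ {0}`. -/
def ZStar.next (j : ZStar) : ZStar :=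
  ⟨if j.1 = -1 then 1 else j.1 + 1, by split_ifs <;> omega⟩

/-- The left neighbour in `ℤ \ {0}`. -/
def ZStar.prev (j : ZStar) : ZStar :=
  ⟨if j.1 = 1 then -1 else j.1 - 1, by split_ifs <;> omega⟩

theorem exists_coupledLaplacian_clm (α β : ℝ) :
    ∃ A : SeqSpace 2 →L[ℂ] SeqSpace 2, ∀ f j, A f j = coupledLaplacian α β f j := by
  have hn : Function.Injective ZStar.next := by
    rintro ⟨a, ha⟩ ⟨b, hb⟩ h
    simp only [ZStar.next, Subtype.mk.injEq] at h ⊢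
    split_ifs at h <;> omega
  have hp : Function.Injective ZStar.prev := by
    rintro ⟨a, ha⟩ ⟨b, hb⟩ h
    simp only [ZStar.prev, Subtype.mk.injEq] at h ⊢
    split_ifs at h <;> omega
  have hbd : ∀ (x y z : ℂ) (k : ℤ) (j : ZStar),
      ‖if j.1 = k then x else if j.1 < 0 then y else z‖ ≤ ‖x‖ + ‖y‖ + ‖z‖ := by
    intro x y z k j
    split_ifs <;> linarith [norm_nonneg x, norm_nonneg y, norm_nonneg z]
  obtain ⟨T₁, h₁⟩ := exists_weighted_comp
    (fun j => if j.1 = -1 then (α * (β / (α + β)) : ℂ) else if j.1 < 0 then (α : ℂ) else β)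
    ZStar.next hn (hbd _ _ _ _)
  obtain ⟨T₂, h₂⟩ := exists_weighted_comp
    (fun j => if j.1 = 1 then (β * (α / (α + β)) : ℂ) else if j.1 < 0 then (α : ℂ) else β)
    ZStar.prev hp (hbd _ _ _ _)
  obtain ⟨T₃, h₃⟩ := exists_weighted_comp
    (fun j => if j.1 = -1 then (α * (α / (α + β)) - 2 * α : ℂ) else
      if j.1 < 0 then (-2 * α : ℂ) else -2 * β) id Function.injective_id (hbd _ _ _ _)
  obtain ⟨T₄, h₄⟩ := exists_weighted_comp
    (fun j => if j.1 = 1 then (β * (β / (α + β)) : ℂ) else if j.1 < 0 then (0 : ℂ) else 0)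
    id Function.injective_id (hbd _ _ _ _)
  refine ⟨T₁ + T₂ + T₃ + T₄, fun f j => ?_⟩
  change T₁ f j + T₂ f j + T₃ f j + T₄ f j = _
  rw [h₁, h₂, h₃, h₄]
  obtain ⟨j, hj⟩ := j
  by_cases h1 : j = 1
  · subst h1
    simp [ZStar.next, ZStar.prev, coupledLaplacian, discreteLaplacian, extendAtZero,
      interfaceValue]
    ring
  by_cases h2 : j = -1
  · subst h2
    simp [ZStar.next, ZStar.prev, coupledLaplacian, discreteLaplacian, extendAtZero,
      interfaceValue]
    ring
  have e1 : j + 1 ≠ 0 := by omega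
  have e2 : j - 1 ≠ 0 := by omega
  simp only [ZStar.next, ZStar.prev, coupledLaplacian, discreteLaplacian, extendAtZero, h1, h2,
    e1, e2, hj, dite_false, if_false, id]
  split_ifs <;> ring

theorem exists_flow (α β : ℝ) :
    ∃ S : ℝ → SeqSpace 2 →L[ℂ] SeqSpace 2, (∀ φ, S 0 φ = φ) ∧ (∀ φ, Continuous fun t => S t φ) ∧
      ∀ φ t j, HasDerivAt (fun s => S s φ j) (Complex.I * coupledLaplacian α β (S t φ) j) t := by
  obtain ⟨A, hA⟩ := exists_coupledLaplacian_clm α β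
  have hexp : ∀ (φ : SeqSpace 2) t, HasDerivAt (fun s : ℝ => NormedSpace.exp (s • (Complex.I • A)) φ)
      ((Complex.I • A) (NormedSpace.exp (t • (Complex.I • A)) φ)) t := fun φ t => by
    have h := hasDerivAt_exp_smul_const' (𝕂 := ℝ) (Complex.I • A) t
    have h' := ((ContinuousLinearMap.apply ℂ (SeqSpace 2) φ).restrictScalars ℝ).hasFDerivAt.comp_hasDerivAt t h
    exact h'
  refine ⟨fun t => NormedSpace.exp (t • (Complex.I • A)), fun φ => by simp, fun φ => ?_, ?_⟩
  · exact continuous_iff_continuousAt.2 fun t => (hexp φ t).continuousAt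
  · intro φ t j
    have h := ((lp.evalCLM ℂ (fun _ : ZStar => ℂ) (2 : ℝ≥0∞) j).restrictScalars ℝ).hasFDerivAt.comp_hasDerivAt
      t (hexp φ t)
    refine h.congr_deriv ?_
    change Complex.I * (A _) j = _
    rw [hA]

theorem exists_bound_of_continuous {U : ℝ → SeqSpace 2} (hU : Continuous U) (T : ℝ) :
    ∃ B, ∀ t ∈ Set.Icc (-T) T, ∀ j, ‖U t j‖ ≤ B := by
  obtain ⟨B, hB⟩ := isCompact_Icc.exists_bound_of_continuousOn (s := Set.Icc (-T) T)
    hU.continuousOn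
  exact ⟨B, fun t ht j => (lp.norm_apply_le_norm two_ne_zero _ _).trans (hB t ht)⟩

theorem continuous_apply_of_continuous {U : ℝ → SeqSpace 2} (hU : Continuous U) (j : ZStar) :
    Continuous fun t => U t j :=
  (lp.evalCLM ℂ (fun _ : ZStar => ℂ) (2 : ℝ≥0∞) j).continuous.comp hU

/-- A column of the fundamental solution: bounded, and equal to `δ_k` at time `0`. -/
structure IsKernelColumn (α β : ℝ) (k : ZStar) (K : ℝ → ZStar → ℂ) : Prop where
  hasDerivAt : ∀ t j, HasDerivAt (fun s => K s j) (Complex.I * coupledLaplacian α β (K t) j) t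
  zero : ∀ j, K 0 j = Pi.single (M := fun _ => ℂ) k 1 j
  bounded : ∃ B, ∀ t j, ‖K t j‖ ≤ B

theorem existsUnique_and_decay_of_kernel {b₁ b₂ : ℝ} (hb₁ : 0 < b₁) (hb₂ : 0 < b₂)
    (hK : ∃ C : ℝ, 0 < C ∧ ∀ k, ∃ K, IsKernelColumn (b₁ ^ 2)⁻¹ (b₂ ^ 2)⁻¹ k K ∧
      ∀ t j, ‖K t j‖ ≤ C * (|t| + 1) ^ (-(1 / 3) : ℝ)) :
    (∀ φ : SeqSpace 2, ∃! U : C(ℝ, SeqSpace 2), IsCoupledSolution b₁ b₂ φ U) ∧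
    (∃ C : ℝ, 0 < C ∧
      ∀ (φ : SeqSpace 1) (U : C(ℝ, SeqSpace 2)),
        IsCoupledSolution b₁ b₂ (SeqSpace.incl one_le_two φ) U →
        ∀ t : ℝ, ‖SeqSpace.incl (q := ∞) le_top (U t)‖
          ≤ C * (|t| + 1) ^ (-(1 / 3) : ℝ) * ‖φ‖) := by
  have hα : 0 < (b₁ ^ 2)⁻¹ := by positivity
  have hβ : 0 < (b₂ ^ 2)⁻¹ := by positivity
  obtain ⟨S, hS0, hSc, hSd⟩ := exists_flow (b₁ ^ 2)⁻¹ (b₂ ^ 2)⁻¹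
  have hflow : ∀ (φ : SeqSpace 2) (U : C(ℝ, SeqSpace 2)), IsCoupledSolution b₁ b₂ φ U →
      ∀ t, U t = S t φ := by
    intro φ U hsol t
    obtain ⟨h1, h2⟩ := (isCoupledSolution_iff hb₁ hb₂ φ
      (continuous_apply_of_continuous U.continuous)).1 hsol
    refine lp.ext (funext fun j => ?_)
    exact eq_of_hasDerivAt_coupledLaplacian hα hβ (U := fun t => U t) (V := fun t => S t φ) h1
      (hSd φ) (fun j => by rw [h2, hS0]) (exists_bound_of_continuous U.continuous)
      (exists_bound_of_continuous (hSc φ)) t j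
  refine ⟨fun φ => ⟨⟨fun t => S t φ, hSc φ⟩, ?_, fun U hsol => ?_⟩, ?_⟩
  · refine (isCoupledSolution_iff hb₁ hb₂ φ (continuous_apply_of_continuous (hSc φ))).2
      ⟨hSd φ, fun j => ?_⟩
    rw [hS0]
  · exact ContinuousMap.ext fun t => hflow φ U hsol t
  · obtain ⟨C, hC, hcol⟩ := hK
    refine ⟨C, hC, fun φ U hsol t => ?_⟩
    rw [hflow _ U hsol t]
    have hk : ∀ k j, ‖S t (lp.single 2 k (1 : ℂ)) j‖ ≤ C * (|t| + 1) ^ (-(1 / 3) : ℝ) := by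
      intro k j
      obtain ⟨K, hKc, hKb⟩ := hcol k
      obtain ⟨B, hB⟩ := hKc.bounded
      rw [eq_of_hasDerivAt_coupledLaplacian hα hβ (U := fun t => S t (lp.single 2 k (1 : ℂ)))
        (V := K) (hSd _) hKc.hasDerivAt (fun j => by rw [hS0, hKc.zero]; rfl)
        (exists_bound_of_continuous (hSc _)) (fun T => ⟨B, fun t _ => hB t⟩) t j]
      exact hKb t j
    have h1 : Summable fun k => ‖φ k‖ := by
      simpa using (lp.memℓp φ).summable (by simp)
    have hn1 : ‖φ‖ = ∑' k, ‖φ k‖ := by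
      simpa using lp.norm_eq_tsum_rpow (by simp) φ
    refine lp.norm_le_of_forall_le (by positivity) fun j => ?_
    change ‖S t (SeqSpace.incl one_le_two φ) j‖ ≤ _
    have hsum := (((lp.evalCLM ℂ (fun _ : ZStar => ℂ) (2 : ℝ≥0∞) j).comp (S t)).hasSum
      (lp.hasSum_single (by simp) (SeqSpace.incl one_le_two φ)))
    have hterm : ∀ k, ‖((lp.evalCLM ℂ (fun _ : ZStar => ℂ) (2 : ℝ≥0∞) j).comp (S t))
        (lp.single 2 k (SeqSpace.incl one_le_two φ k))‖
        ≤ C * (|t| + 1) ^ (-(1 / 3) : ℝ) * ‖φ k‖ := by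
      intro k
      have e : lp.single (E := fun _ : ZStar => ℂ) 2 k (SeqSpace.incl one_le_two φ k)
          = φ k • lp.single 2 k (1 : ℂ) := by
        rw [← lp.single_smul, smul_eq_mul, mul_one]
        rfl
      rw [e, map_smul, norm_smul, mul_comm]
      exact mul_le_mul_of_nonneg_right (hk k j) (norm_nonneg _)
    have := tsum_of_norm_bounded (h1.mul_left (C * (|t| + 1) ^ (-(1 / 3) : ℝ))).hasSum hterm
    rw [hsum.tsum_eq, tsum_mul_left, ← hn1] at this
    exact this

open MeasureTheory Set

theorem norm_integral_cexp_le_of_le_abs_deriv {f f' f'' : ℝ → ℝ} {a b r : ℝ} (hab : a ≤ b)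
    (hr : 0 < r) (h1 : ∀ x ∈ Icc a b, HasDerivAt f (f' x) x)
    (h2 : ∀ x ∈ Icc a b, HasDerivAt f' (f'' x) x) (hc : ContinuousOn f'' (Icc a b))
    (h0 : ∀ x ∈ Icc a b, 0 ≤ f'' x) (hf : ∀ x ∈ Icc a b, r ≤ |f' x|) :
    ‖∫ x in a..b, Complex.exp (Complex.I * f x)‖ ≤ 4 / r := by
  have hI : uIcc a b = Icc a b := uIcc_of_le hab
  have hne : ∀ x ∈ Icc a b, f' x ≠ 0 := fun x hx h => by
    have := hf x hx
    rw [h, abs_zero] at this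
    linarith
  have hcf : ContinuousOn f (Icc a b) := fun x hx => (h1 x hx).continuousAt.continuousWithinAt
  have hcf' : ContinuousOn f' (Icc a b) := fun x hx => (h2 x hx).continuousAt.continuousWithinAt
  have hu : ∀ x ∈ uIcc a b, HasDerivAt (fun x => ((f' x)⁻¹ : ℂ))
      (((-f'' x / f' x ^ 2 : ℝ)) : ℂ) x := fun x hx => by
    rw [hI] at hx
    have := ((h2 x hx).inv (hne x hx)).ofReal_comp
    convert this using 1
    ext y
    simp
  have hv : ∀ x ∈ uIcc a b, HasDerivAt (fun x => -Complex.I * Complex.exp (Complex.I * f x))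
      (f' x * Complex.exp (Complex.I * f x)) x := fun x hx => by
    rw [hI] at hx
    have := ((((h1 x hx).ofReal_comp).const_mul Complex.I).cexp).const_mul (-Complex.I)
    refine this.congr_deriv ?_
    linear_combination (-f' x * Complex.exp (Complex.I * f x)) * Complex.I_mul_I
  have hu' : IntervalIntegrable (fun x => (((-f'' x / f' x ^ 2 : ℝ)) : ℂ)) volume a b := by
    refine ContinuousOn.intervalIntegrable ?_
    rw [hI]
    exact Complex.continuous_ofReal.comp_continuousOn
      ((hc.neg).div (hcf'.pow 2) fun x hx => pow_ne_zero 2 (hne x hx))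
  have hexp : ContinuousOn (fun x => Complex.exp (Complex.I * f x)) (Icc a b) :=
    (continuousOn_const.mul (Complex.continuous_ofReal.comp_continuousOn hcf)).cexp
  have hv' : IntervalIntegrable (fun x => f' x * Complex.exp (Complex.I * f x)) volume a b := by
    refine ContinuousOn.intervalIntegrable ?_
    rw [hI]
    exact (Complex.continuous_ofReal.comp_continuousOn hcf').mul hexp
  have hparts := intervalIntegral.integral_mul_deriv_eq_deriv_mul hu hv hu' hv'
  have he : ∫ x in a..b, ((f' x)⁻¹ : ℂ) * (f' x * Complex.exp (Complex.I * f x))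
      = ∫ x in a..b, Complex.exp (Complex.I * f x) := by
    refine intervalIntegral.integral_congr fun x hx => ?_
    rw [hI] at hx
    have : (f' x : ℂ) ≠ 0 := by exact_mod_cast hne x hx
    field_simp
  have hn : ∀ x, ‖-Complex.I * Complex.exp (Complex.I * f x)‖ = 1 := fun x => by
    rw [norm_mul, norm_neg, Complex.norm_I, mul_comm Complex.I, Complex.norm_exp_ofReal_mul_I,
      one_mul]
  have hr' : ∀ x ∈ Icc a b, |(f' x)⁻¹| ≤ 1 / r := fun x hx => by
    rw [abs_inv, one_div]
    exact inv_anti₀ hr (hf x hx)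
  have hint : ‖∫ x in a..b, (((-f'' x / f' x ^ 2 : ℝ)) : ℂ) *
      (-Complex.I * Complex.exp (Complex.I * f x))‖ ≤ (f' a)⁻¹ - (f' b)⁻¹ := by
    have hd : ∀ x ∈ uIcc a b, HasDerivAt (fun x => -(f' x)⁻¹) (f'' x / f' x ^ 2) x := fun x hx => by
      rw [hI] at hx
      exact ((h2 x hx).inv (hne x hx)).neg.congr_deriv (by ring)
    have hi : IntervalIntegrable (fun x => f'' x / f' x ^ 2) volume a b := by
      refine ContinuousOn.intervalIntegrable ?_
      rw [hI]
      exact hc.div (hcf'.pow 2) fun x hx => pow_ne_zero 2 (hne x hx)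
    have := intervalIntegral.integral_eq_sub_of_hasDerivAt hd hi
    calc _ ≤ ∫ x in a..b, f'' x / f' x ^ 2 := by
          refine intervalIntegral.norm_integral_le_of_norm_le hab ?_ hi
          refine Filter.Eventually.of_forall fun x hx => ?_
          rw [norm_mul, hn, mul_one, Complex.norm_real, Real.norm_eq_abs, neg_div, abs_neg,
            abs_of_nonneg]
          exact div_nonneg (h0 x (Ioc_subset_Icc_self hx)) (sq_nonneg _)
      _ = _ := by rw [this]; ring
  have ha := abs_le.1 (hr' a ⟨le_rfl, hab⟩)
  have hb := abs_le.1 (hr' b ⟨hab, le_rfl⟩)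
  rw [← he, hparts]
  refine (norm_sub_le _ _).trans ((add_le_add (norm_sub_le _ _) hint).trans ?_)
  rw [norm_mul, hn, norm_mul, hn, ← Complex.ofReal_inv, ← Complex.ofReal_inv, Complex.norm_real,
    Complex.norm_real, Real.norm_eq_abs, Real.norm_eq_abs]
  have e : 4 / r = 4 * (1 / r) := by ring
  rw [e]
  linarith [hr' a ⟨le_rfl, hab⟩, hr' b ⟨hab, le_rfl⟩, ha.1, ha.2, hb.1, hb.2]

/-- A continuous monotone function is large off a short interval if its sublevel set is short. -/
theorem exists_split_of_monotoneOn {F : ℝ → ℝ} {a b κ L : ℝ} (hab : a ≤ b) (hκ : 0 < κ)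
    (hL : 0 ≤ L) (hc : ContinuousOn F (Icc a b)) (hm : MonotoneOn F (Icc a b))
    (hgap : ∀ x ∈ Icc a b, ∀ y ∈ Icc a b, x ≤ y → |F x| ≤ κ → |F y| ≤ κ → y - x ≤ L) :
    ∃ c d, a ≤ c ∧ c ≤ d ∧ d ≤ b ∧ d - c ≤ L ∧ (c = a ∨ ∀ x ∈ Icc a c, F x ≤ -κ) ∧
      (d = b ∨ ∀ x ∈ Icc d b, κ ≤ F x) := by
  have ha : a ∈ Icc a b := ⟨le_rfl, hab⟩
  have hb : b ∈ Icc a b := ⟨hab, le_rfl⟩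
  by_cases h1 : F b ≤ -κ
  · exact ⟨b, b, hab, le_rfl, le_rfl, by simpa using hL,
      Or.inr fun x hx => (hm hx hb hx.2).trans h1, Or.inl rfl⟩
  by_cases h2 : κ ≤ F a
  · exact ⟨a, a, le_rfl, le_rfl, hab, by simpa using hL, Or.inl rfl,
      Or.inr fun x hx => h2.trans (hm ha hx hx.1)⟩
  push Not at h1 h2
  have hcex : ∃ c ∈ Icc a b, |F c| ≤ κ ∧ (c = a ∨ F c = -κ) := by
    by_cases h3 : -κ < F a
    · exact ⟨a, ha, abs_le.2 ⟨h3.le, h2.le⟩, Or.inl rfl⟩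
    · push Not at h3
      obtain ⟨c, hc1, hc2⟩ := intermediate_value_Icc hab hc ⟨h3, h1.le⟩
      exact ⟨c, hc1, by rw [hc2, abs_neg, abs_of_pos hκ], Or.inr hc2⟩
  have hdex : ∃ d ∈ Icc a b, |F d| ≤ κ ∧ (d = b ∨ F d = κ) := by
    by_cases h3 : F b < κ
    · exact ⟨b, hb, abs_le.2 ⟨h1.le, h3.le⟩, Or.inl rfl⟩
    · push Not at h3
      obtain ⟨d, hd1, hd2⟩ := intermediate_value_Icc hab hc ⟨h2.le, h3⟩
      exact ⟨d, hd1, by rw [hd2, abs_of_pos hκ], Or.inr hd2⟩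
  obtain ⟨c, hcI, hcκ, hc'⟩ := hcex
  obtain ⟨d, hdI, hdκ, hd'⟩ := hdex
  have hcd : c ≤ d := by
    rcases hc' with rfl | hc'
    · exact hdI.1
    rcases hd' with rfl | hd'
    · exact hcI.2
    by_contra! hlt
    have := hm hdI hcI hlt.le
    linarith
  refine ⟨c, d, hcI.1, hcd, hdI.2, hgap c hcI d hdI hcd hcκ hdκ, hc'.imp_right ?_,
    hd'.imp_right ?_⟩
  · exact fun h x hx => h ▸ hm ⟨hx.1, hx.2.trans hcI.2⟩ hcI hx.2
  · exact fun h x hx => h ▸ hm hdI ⟨hdI.1.trans hx.1, hx.2⟩ hx.1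

theorem norm_integral_le_of_split {g : ℝ → ℂ} {a b c d B₁ B₂ L : ℝ} (hcd : c ≤ d) (hL : d - c ≤ L)
    (hab : a ≤ c) (hdb : d ≤ b)
    (hg : ContinuousOn g (Icc a b)) (hg1 : ∀ x, ‖g x‖ ≤ 1) (h1 : ‖∫ x in a..c, g x‖ ≤ B₁)
    (h2 : ‖∫ x in d..b, g x‖ ≤ B₂) : ‖∫ x in a..b, g x‖ ≤ L + (B₁ + B₂) := by
  have hi : ∀ x ∈ Icc a b, ∀ y ∈ Icc a b, IntervalIntegrable g volume x y := fun x hx y hy =>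
    (hg.mono (uIcc_subset_Icc hx hy)).intervalIntegrable
  have ha : a ∈ Icc a b := ⟨le_rfl, by linarith⟩
  have hb : b ∈ Icc a b := ⟨by linarith, le_rfl⟩
  have hc : c ∈ Icc a b := ⟨hab, by linarith⟩
  have hd : d ∈ Icc a b := ⟨by linarith, hdb⟩
  rw [← intervalIntegral.integral_add_adjacent_intervals (hi a ha c hc) (hi c hc b hb),
    ← intervalIntegral.integral_add_adjacent_intervals (hi c hc d hd) (hi d hd b hb)]
  have hm : ‖∫ x in c..d, g x‖ ≤ 1 * |d - c| :=
    intervalIntegral.norm_integral_le_of_norm_le_const fun x _ => hg1 x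
  rw [abs_of_nonneg (by linarith)] at hm
  refine (norm_add_le _ _).trans ((add_le_add_right (norm_add_le _ _) _).trans ?_)
  linarith

theorem norm_cexp_I_mul_ofReal_le (x : ℝ) : ‖Complex.exp (Complex.I * x)‖ ≤ 1 := by
  rw [mul_comm, Complex.norm_exp_ofReal_mul_I]

theorem norm_integral_cexp_neg (f : ℝ → ℝ) (a b : ℝ) :
    ‖∫ x in a..b, Complex.exp (Complex.I * ((-f x : ℝ) : ℂ))‖
      = ‖∫ x in a..b, Complex.exp (Complex.I * f x)‖ := by
  rw [← RCLike.norm_conj (∫ x in a..b, Complex.exp (Complex.I * f x)),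
    intervalIntegral, intervalIntegral, map_sub, ← integral_conj, ← integral_conj]
  congr 3 <;>
  · ext x
    rw [← Complex.exp_conj]
    simp

theorem norm_integral_cexp_le_of_le_deriv2 {f f' f'' : ℝ → ℝ} {a b r : ℝ} (hab : a ≤ b)
    (hr : 0 < r) (h1 : ∀ x ∈ Icc a b, HasDerivAt f (f' x) x)
    (h2 : ∀ x ∈ Icc a b, HasDerivAt f' (f'' x) x) (hc : ContinuousOn f'' (Icc a b))
    (hf : ∀ x ∈ Icc a b, r ≤ f'' x) :
    ‖∫ x in a..b, Complex.exp (Complex.I * f x)‖ ≤ 10 / √r := by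
  have hs : 0 < √r := Real.sqrt_pos.2 hr
  have hss : √r * √r = r := Real.mul_self_sqrt hr.le
  have hcf' : ContinuousOn f' (Icc a b) := fun x hx => (h2 x hx).continuousAt.continuousWithinAt
  have hgrow : ∀ x ∈ Icc a b, ∀ y ∈ Icc a b, x ≤ y → r * (y - x) ≤ f' y - f' x := by
    intro x hx y hy hxy
    refine (convex_Icc a b).mul_sub_le_image_sub_of_le_deriv hcf' ?_ ?_ x hx y hy hxy
    · exact fun z hz => (h2 z (interior_subset hz)).differentiableAt.differentiableWithinAt
    · exact fun z hz => by
        rw [(h2 z (interior_subset hz)).deriv]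
        exact hf z (interior_subset hz)
  have hm : MonotoneOn f' (Icc a b) := fun x hx y hy hxy => by
    nlinarith [hgrow x hx y hy hxy, mul_nonneg hr.le (sub_nonneg.2 hxy)]
  obtain ⟨c, d, hac, hcd, hdb, hL, hc1, hd1⟩ := exists_split_of_monotoneOn hab hs
    (L := 2 / √r) (by positivity) hcf' hm (fun x hx y hy hxy hx1 hy1 => by
      have := hgrow x hx y hy hxy
      rw [le_div_iff₀ hs]
      rw [abs_le] at hx1 hy1
      have h3 : √r * ((y - x) * √r) ≤ √r * 2 := by nlinarith
      exact le_of_mul_le_mul_left h3 hs)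
  have hgc : ContinuousOn (fun x => Complex.exp (Complex.I * f x)) (Icc a b) :=
    (continuousOn_const.mul (Complex.continuous_ofReal.comp_continuousOn
      fun x hx => (h1 x hx).continuousAt.continuousWithinAt)).cexp
  have hsub1 : Icc a c ⊆ Icc a b := Icc_subset_Icc_right (hcd.trans hdb)
  have hsub2 : Icc d b ⊆ Icc a b := Icc_subset_Icc_left (hac.trans hcd)
  have hpos : 0 ≤ 4 / √r := by positivity
  have := norm_integral_le_of_split (B₁ := 4 / √r) (B₂ := 4 / √r) hcd hL hac hdb hgc
    (fun x => norm_cexp_I_mul_ofReal_le _)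
    (by
      rcases hc1 with rfl | hc1
      · simpa using hpos
      · exact norm_integral_cexp_le_of_le_abs_deriv hac hs (fun x hx => h1 x (hsub1 hx))
          (fun x hx => h2 x (hsub1 hx)) (hc.mono hsub1) (fun x hx => hr.le.trans (hf x (hsub1 hx)))
          (fun x hx => by rw [abs_of_nonpos (by linarith [hc1 x hx])]; linarith [hc1 x hx]))
    (by
      rcases hd1 with rfl | hd1
      · simpa using hpos
      · exact norm_integral_cexp_le_of_le_abs_deriv hdb hs (fun x hx => h1 x (hsub2 hx))
          (fun x hx => h2 x (hsub2 hx)) (hc.mono hsub2) (fun x hx => hr.le.trans (hf x (hsub2 hx)))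
          (fun x hx => (hd1 x hx).trans (le_abs_self _)))
  refine this.trans (le_of_eq ?_)
  ring

/-- Van der Corput estimate when the second derivative of the phase is monotone and small only
on a short interval. -/
theorem norm_integral_cexp_le_of_monotoneOn_deriv2 {f f' f'' : ℝ → ℝ} {a b κ L : ℝ} (hab : a ≤ b)
    (hκ : 0 < κ) (hL : 0 ≤ L) (h1 : ∀ x ∈ Icc a b, HasDerivAt f (f' x) x)
    (h2 : ∀ x ∈ Icc a b, HasDerivAt f' (f'' x) x) (hc : ContinuousOn f'' (Icc a b))
    (hm : MonotoneOn f'' (Icc a b))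
    (hgap : ∀ x ∈ Icc a b, ∀ y ∈ Icc a b, x ≤ y → |f'' x| ≤ κ → |f'' y| ≤ κ → y - x ≤ L) :
    ‖∫ x in a..b, Complex.exp (Complex.I * f x)‖ ≤ L + 20 / √κ := by
  obtain ⟨c, d, hac, hcd, hdb, hL, hc1, hd1⟩ := exists_split_of_monotoneOn hab hκ hL hc hm hgap
  have hgc : ContinuousOn (fun x => Complex.exp (Complex.I * f x)) (Icc a b) :=
    (continuousOn_const.mul (Complex.continuous_ofReal.comp_continuousOn
      fun x hx => (h1 x hx).continuousAt.continuousWithinAt)).cexp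
  have hsub1 : Icc a c ⊆ Icc a b := Icc_subset_Icc_right (hcd.trans hdb)
  have hsub2 : Icc d b ⊆ Icc a b := Icc_subset_Icc_left (hac.trans hcd)
  have hpos : 0 ≤ 10 / √κ := by positivity
  have := norm_integral_le_of_split (B₁ := 10 / √κ) (B₂ := 10 / √κ) hcd hL hac hdb hgc
    (fun x => norm_cexp_I_mul_ofReal_le _)
    (by
      rcases hc1 with rfl | hc1
      · simpa using hpos
      · rw [← norm_integral_cexp_neg]
        exact norm_integral_cexp_le_of_le_deriv2 hac hκ (f' := fun x => -f' x)
          (f'' := fun x => -f'' x) (fun x hx => (h1 x (hsub1 hx)).neg)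
          (fun x hx => (h2 x (hsub1 hx)).neg) (hc.mono hsub1).neg
          (fun x hx => by linarith [hc1 x hx]))
    (by
      rcases hd1 with rfl | hd1
      · simpa using hpos
      · exact norm_integral_cexp_le_of_le_deriv2 hdb hκ (fun x hx => h1 x (hsub2 hx))
          (fun x hx => h2 x (hsub2 hx)) (hc.mono hsub2) hd1)
  refine this.trans (le_of_eq ?_)
  ring

/-- Inserting an amplitude of bounded variation into an integral with bounded primitive. -/
theorem norm_integral_mul_le_of_primitive_le {e A A' : ℝ → ℂ} {a b B : ℝ} (hab : a ≤ b)
    (he : ContinuousOn e (Icc a b)) (hA : ∀ x ∈ Icc a b, HasDerivAt A (A' x) x)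
    (hA' : ContinuousOn A' (Icc a b)) (hB : ∀ x ∈ Icc a b, ‖∫ y in a..x, e y‖ ≤ B) :
    ‖∫ x in a..b, A x * e x‖ ≤ B * (‖A b‖ + ∫ x in a..b, ‖A' x‖) := by
  have hI : uIcc a b = Icc a b := uIcc_of_le hab
  have hei : IntervalIntegrable e volume a b := by
    rw [← hI] at he
    exact he.intervalIntegrable
  have hA'i : IntervalIntegrable A' volume a b := by
    rw [← hI] at hA'
    exact hA'.intervalIntegrable
  have hE : ∀ x ∈ Ioo (min a b) (max a b),
      HasDerivWithinAt (fun x => ∫ y in a..x, e y) (e x) (Ioi x) x := fun x hx => by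
    rw [min_eq_left hab, max_eq_right hab] at hx
    refine (intervalIntegral.integral_hasDerivAt_right ?_ ?_ ?_).hasDerivWithinAt
    · exact (he.mono (uIcc_subset_Icc ⟨le_rfl, hab⟩ (Ioo_subset_Icc_self hx))).intervalIntegrable
    · exact (he.mono Ioo_subset_Icc_self).stronglyMeasurableAtFilter isOpen_Ioo x hx
    · exact he.continuousAt (Icc_mem_nhds hx.1 hx.2)
  have hEc : ContinuousOn (fun x => ∫ y in a..x, e y) (uIcc a b) :=
    intervalIntegral.continuousOn_primitive_interval (by
      rw [← intervalIntegrable_iff']; exact hei)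
  have hAc : ContinuousOn A (uIcc a b) := fun x hx => by
    rw [hI] at hx
    exact (hA x hx).continuousAt.continuousWithinAt
  have hparts := intervalIntegral.integral_mul_deriv_eq_deriv_mul_of_hasDeriv_right hAc hEc
    (fun x hx => (hA x (by
      rw [min_eq_left hab, max_eq_right hab] at hx
      exact Ioo_subset_Icc_self hx)).hasDerivWithinAt) hE hA'i hei
  rw [hparts]
  simp only [intervalIntegral.integral_same, mul_zero, sub_zero]
  have hb : ‖A b * ∫ y in a..b, e y‖ ≤ B * ‖A b‖ := by
    rw [norm_mul, mul_comm]
    exact mul_le_mul_of_nonneg_right (hB b ⟨hab, le_rfl⟩) (norm_nonneg _)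
  have hi : ‖∫ x in a..b, A' x * ∫ y in a..x, e y‖ ≤ ∫ x in a..b, B * ‖A' x‖ := by
    refine intervalIntegral.norm_integral_le_of_norm_le hab ?_ (hA'i.norm.const_mul B)
    refine Filter.Eventually.of_forall fun x hx => ?_
    rw [norm_mul, mul_comm]
    exact mul_le_mul_of_nonneg_right (hB x (Ioc_subset_Icc_self hx)) (norm_nonneg _)
  rw [intervalIntegral.integral_const_mul] at hi
  refine (norm_sub_le _ _).trans ?_
  linarith

/-- The square root that is continuous on the closed upper half plane. -/
noncomputable def uhpSqrt (z : ℂ) : ℂ := ⟨√((‖z‖ + z.re) / 2), √((‖z‖ - z.re) / 2)⟩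

theorem continuous_uhpSqrt : Continuous uhpSqrt := by
  have : uhpSqrt = fun z : ℂ => ((√((‖z‖ + z.re) / 2) : ℝ) : ℂ)
      + (√((‖z‖ - z.re) / 2) : ℝ) * Complex.I := by
    ext z
    apply Complex.ext <;> simp [uhpSqrt]
  rw [this]
  fun_prop

theorem uhpSqrt_re_nonneg (z : ℂ) : 0 ≤ (uhpSqrt z).re := Real.sqrt_nonneg _

theorem uhpSqrt_im_nonneg (z : ℂ) : 0 ≤ (uhpSqrt z).im := Real.sqrt_nonneg _

theorem uhpSqrt_sq {z : ℂ} (hz : 0 ≤ z.im) : uhpSqrt z ^ 2 = z := by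
  have h1 : 0 ≤ (‖z‖ + z.re) / 2 := by linarith [neg_abs_le z.re, Complex.abs_re_le_norm z]
  have h2 : 0 ≤ (‖z‖ - z.re) / 2 := by linarith [le_abs_self z.re, Complex.abs_re_le_norm z]
  have h3 : √((‖z‖ + z.re) / 2) * √((‖z‖ - z.re) / 2) = z.im / 2 := by
    rw [← Real.sqrt_mul h1]
    have : (‖z‖ + z.re) / 2 * ((‖z‖ - z.re) / 2) = (z.im / 2) ^ 2 := by
      have := Complex.sq_norm z
      rw [Complex.normSq_apply] at this
      linear_combination this / 4
    rw [this, Real.sqrt_sq (by positivity)]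
  rw [sq]
  apply Complex.ext
  · simp only [Complex.mul_re, uhpSqrt, Real.mul_self_sqrt h1, Real.mul_self_sqrt h2]
    ring
  · simp only [Complex.mul_im, uhpSqrt]
    linarith

theorem differentiableAt_uhpSqrt {z : ℂ} (hz : 0 < z.im) : DifferentiableAt ℂ uhpSqrt z := by
  have hne : uhpSqrt z ≠ 0 := fun h => by
    have := uhpSqrt_sq hz.le
    rw [h] at this
    rw [← this] at hz
    simp at hz
  have hd : HasDerivAt (fun w : ℂ => w ^ 2) (2 * uhpSqrt z) (uhpSqrt z) := by
    simpa using hasDerivAt_pow 2 (uhpSqrt z)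
  refine (HasDerivAt.of_local_left_inverse continuous_uhpSqrt.continuousAt hd
    (mul_ne_zero two_ne_zero hne) ?_).differentiableAt
  filter_upwards [(isOpen_lt continuous_const Complex.continuous_im).mem_nhds hz] with w hw
  exact uhpSqrt_sq (le_of_lt hw)

theorem uhpSqrt_ofReal_of_nonneg {x : ℝ} (hx : 0 ≤ x) : uhpSqrt x = √x := by
  apply Complex.ext <;> simp [uhpSqrt, abs_of_nonneg hx]

theorem uhpSqrt_ofReal_of_nonpos {x : ℝ} (hx : x ≤ 0) : uhpSqrt x = Complex.I * √(-x) := by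
  have h : (-x - x) / 2 = -x := by ring
  apply Complex.ext
  · simp [uhpSqrt, abs_of_nonpos hx]
  · simp only [uhpSqrt, Complex.norm_real, Real.norm_eq_abs, abs_of_nonpos hx, Complex.ofReal_re, h]
    simp

theorem uhpSqrt_neg_ofReal (x : ℝ) :
    uhpSqrt (-x) = Complex.I * (starRingEnd ℂ) (uhpSqrt x) := by
  apply Complex.ext <;> simp [uhpSqrt, sub_eq_add_neg]

/-- The solution `s` of `s ^ 2 - 2 i ν s = p ^ 2` with `‖s‖ ≤ p` for `ν` in the closed upper
half plane. -/
noncomputable def halfWave (p : ℝ) (ν : ℂ) : ℂ :=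
  Complex.I * ν - Complex.I * (uhpSqrt (ν - p) * uhpSqrt (ν + p))

section HalfWave

variable {p : ℝ} {ν : ℂ}

theorem continuous_halfWave (p : ℝ) : Continuous (halfWave p) := by
  have := continuous_uhpSqrt
  unfold halfWave
  fun_prop

theorem differentiableAt_halfWave (hν : 0 < ν.im) : DifferentiableAt ℂ (halfWave p) ν := by
  have h1 : DifferentiableAt ℂ (fun ν => uhpSqrt (ν - p)) ν :=
    (differentiableAt_uhpSqrt (z := ν - p) (by simpa using hν)).comp ν
      (differentiableAt_id.sub_const (p : ℂ))
  have h2 : DifferentiableAt ℂ (fun ν => uhpSqrt (ν + p)) ν :=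
    (differentiableAt_uhpSqrt (z := ν + p) (by simpa using hν)).comp ν
      (differentiableAt_id.add_const (p : ℂ))
  unfold halfWave
  fun_prop

theorem halfWave_sq (hν : 0 ≤ ν.im) : halfWave p ν ^ 2 = p ^ 2 + 2 * Complex.I * ν * halfWave p ν := by
  have h1 := uhpSqrt_sq (z := ν - p) (by simpa using hν)
  have h2 := uhpSqrt_sq (z := ν + p) (by simpa using hν)
  unfold halfWave
  linear_combination (uhpSqrt (ν - p) ^ 2 * uhpSqrt (ν + p) ^ 2 - ν ^ 2) * Complex.I_sq
    - uhpSqrt (ν + p) ^ 2 * h1 - (ν - p) * h2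

theorem norm_halfWave_aux (hν : 0 ≤ ν.im) :
    ∃ x y : ℝ, 0 ≤ x ∧ x ≤ y ∧ x * y = 4 * p ^ 2 ∧ 2 * ‖ν‖ ≤ y ∧ ‖halfWave p ν‖ = x / 2 := by
  have h1 := uhpSqrt_sq (z := ν - p) (by simpa using hν)
  have h2 := uhpSqrt_sq (z := ν + p) (by simpa using hν)
  set a := uhpSqrt (ν - p) with ha
  set b := uhpSqrt (ν + p) with hb
  have ha1 : 0 ≤ a.re := uhpSqrt_re_nonneg _
  have ha2 : 0 ≤ a.im := uhpSqrt_im_nonneg _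
  have hb1 : 0 ≤ b.re := uhpSqrt_re_nonneg _
  have hb2 : 0 ≤ b.im := uhpSqrt_im_nonneg _
  have e1 : ‖b - a‖ ^ 2 = (b.re - a.re) ^ 2 + (b.im - a.im) ^ 2 := by
    rw [Complex.sq_norm, Complex.normSq_apply]; simp; ring
  have e2 : ‖b + a‖ ^ 2 = (b.re + a.re) ^ 2 + (b.im + a.im) ^ 2 := by
    rw [Complex.sq_norm, Complex.normSq_apply]; simp; ring
  have e3 : ‖a‖ ^ 2 = a.re ^ 2 + a.im ^ 2 := by
    rw [Complex.sq_norm, Complex.normSq_apply]; ring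
  have e4 : ‖b‖ ^ 2 = b.re ^ 2 + b.im ^ 2 := by
    rw [Complex.sq_norm, Complex.normSq_apply]; ring
  have m1 := mul_nonneg ha1 hb1
  have m2 := mul_nonneg ha2 hb2
  refine ⟨‖b - a‖ ^ 2, ‖b + a‖ ^ 2, by positivity, by rw [e1, e2]; nlinarith, ?_, ?_, ?_⟩
  · rw [← mul_pow, ← norm_mul]
    have : (b - a) * (b + a) = 2 * p := by linear_combination h2 - h1
    rw [this, norm_mul, Complex.norm_two, Complex.norm_real, mul_pow, Real.norm_eq_abs, sq_abs]
    norm_num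
  · have h : a ^ 2 + b ^ 2 = 2 * ν := by linear_combination h1 + h2
    have : 2 * ‖ν‖ = ‖a ^ 2 + b ^ 2‖ := by rw [h, norm_mul, Complex.norm_two]
    rw [this]
    refine (norm_add_le _ _).trans ?_
    rw [norm_pow, norm_pow, e2, e3, e4]
    nlinarith
  · have : halfWave p ν = Complex.I * (b - a) ^ 2 / 2 := by
      unfold halfWave
      rw [← ha, ← hb]
      linear_combination (-Complex.I / 2) * (h1 + h2)
    rw [this, norm_div, norm_mul, Complex.norm_I, norm_pow, Complex.norm_two, one_mul]

theorem norm_halfWave_le (hp : 0 ≤ p) (hν : 0 ≤ ν.im) : ‖halfWave p ν‖ ≤ p := by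
  obtain ⟨x, y, hx, hxy, h, -, hs⟩ := norm_halfWave_aux (p := p) hν
  rw [hs]
  nlinarith

theorem norm_halfWave_mul_le (hν : 0 ≤ ν.im) : ‖halfWave p ν‖ * ‖ν‖ ≤ p ^ 2 := by
  obtain ⟨x, y, hx, hxy, h, h2, hs⟩ := norm_halfWave_aux (p := p) hν
  rw [hs]
  nlinarith

theorem halfWave_ne_zero (hp : 0 < p) (hν : 0 ≤ ν.im) : halfWave p ν ≠ 0 := by
  intro h
  have := halfWave_sq (p := p) hν
  rw [h] at this
  have hp' : (p : ℂ) ≠ 0 := by exact_mod_cast hp.ne'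
  simp only [ne_eq, OfNat.ofNat_ne_zero, not_false_eq_true, zero_pow, mul_zero, add_zero] at this
  exact pow_ne_zero 2 hp' this.symm

theorem halfWave_add_ne_zero {q : ℝ} (hp : 0 < p) (hq : 0 < q) (hν : 0 ≤ ν.im) :
    halfWave p ν + halfWave q ν ≠ 0 := by
  intro h
  have h1 := halfWave_sq (p := p) hν
  have h2 := halfWave_sq (p := q) hν
  have hs : halfWave q ν = -halfWave p ν := by linear_combination h
  rw [hs] at h2
  have h3 : 2 * halfWave p ν ^ 2 = ((p ^ 2 + q ^ 2 : ℝ) : ℂ) := by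
    push_cast
    linear_combination h1 + h2
  have h4 : 2 * ‖halfWave p ν‖ ^ 2 = p ^ 2 + q ^ 2 := by
    have := congrArg norm h3
    rwa [norm_mul, Complex.norm_two, norm_pow, Complex.norm_real,
      Real.norm_of_nonneg (by positivity)] at this
  have h5 := norm_halfWave_le hp.le hν
  have h6 := norm_halfWave_le hq.le hν
  rw [hs, norm_neg] at h6
  have h7 := norm_nonneg (halfWave p ν)
  have hpq : p = q := by nlinarith
  subst hpq
  have h8 : halfWave p ν = 0 := by linear_combination h / 2
  exact halfWave_ne_zero hp hν h8

theorem norm_inv_halfWave_add_le {q : ℝ} (hp : 0 < p) (hq : 0 < q) (hν : 0 ≤ ν.im)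
    (hN : 2 * (p ^ 2 + q ^ 2) ≤ ‖ν‖ ^ 2) :
    ‖(halfWave p ν + halfWave q ν)⁻¹‖ ≤ 4 * ‖ν‖ / (p ^ 2 + q ^ 2) := by
  have hpos : 0 < p ^ 2 + q ^ 2 := by positivity
  have hν0 : 0 < ‖ν‖ ^ 2 := by linarith
  have h1 := halfWave_sq (p := p) hν
  have h2 := halfWave_sq (p := q) hν
  have h3 : 2 * Complex.I * ν * (halfWave p ν + halfWave q ν)
      = halfWave p ν ^ 2 + halfWave q ν ^ 2 - ((p ^ 2 + q ^ 2 : ℝ) : ℂ) := by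
    push_cast
    linear_combination -h1 - h2
  have hb : ∀ r : ℝ, ‖halfWave r ν‖ ^ 2 * ‖ν‖ ^ 2 ≤ r ^ 4 := fun r => by
    have := norm_halfWave_mul_le (p := r) hν
    calc _ = (‖halfWave r ν‖ * ‖ν‖) ^ 2 := by ring
      _ ≤ (r ^ 2) ^ 2 := by gcongr
      _ = _ := by ring
  have h4 : ‖halfWave p ν‖ ^ 2 + ‖halfWave q ν‖ ^ 2 ≤ (p ^ 2 + q ^ 2) / 2 := by
    have h := add_le_add (hb p) (hb q)
    have h' : p ^ 4 + q ^ 4 ≤ (p ^ 2 + q ^ 2) / 2 * ‖ν‖ ^ 2 := by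
      nlinarith [mul_nonneg (sq_nonneg p) (sq_nonneg q)]
    exact le_of_mul_le_mul_right (by linarith) hν0
  have h5 : (p ^ 2 + q ^ 2) / 2 ≤ 2 * ‖ν‖ * ‖halfWave p ν + halfWave q ν‖ := by
    have e : 2 * ‖ν‖ * ‖halfWave p ν + halfWave q ν‖
        = ‖((p ^ 2 + q ^ 2 : ℝ) : ℂ) - (halfWave p ν ^ 2 + halfWave q ν ^ 2)‖ := by
      rw [norm_sub_rev, ← h3]
      simp
    rw [e]
    have := norm_sub_norm_le ((p ^ 2 + q ^ 2 : ℝ) : ℂ) (halfWave p ν ^ 2 + halfWave q ν ^ 2)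
    rw [Complex.norm_real, Real.norm_of_nonneg hpos.le] at this
    have h' := norm_add_le (halfWave p ν ^ 2) (halfWave q ν ^ 2)
    rw [norm_pow, norm_pow] at h'
    linarith
  have hD : 0 < ‖halfWave p ν + halfWave q ν‖ := norm_pos_iff.2 (halfWave_add_ne_zero hp hq hν)
  rw [norm_inv, inv_le_iff_one_le_mul₀ hD, div_mul_eq_mul_div, one_le_div hpos]
  linarith

theorem halfWave_neg_ofReal (p x : ℝ) :
    halfWave p (-x) = (starRingEnd ℂ) (halfWave p x) := by
  have h1 : uhpSqrt (-x - p) = Complex.I * (starRingEnd ℂ) (uhpSqrt (x + p)) := by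
    have := uhpSqrt_neg_ofReal (x + p)
    push_cast at this
    rw [← this]
    congr 1
    ring
  have h2 : uhpSqrt (-x + p) = Complex.I * (starRingEnd ℂ) (uhpSqrt (x - p)) := by
    have := uhpSqrt_neg_ofReal (x - p)
    push_cast at this
    rw [← this]
    congr 1
    ring
  unfold halfWave
  rw [h1, h2]
  simp only [map_sub, map_mul, Complex.conj_I, Complex.conj_ofReal]
  linear_combination -(Complex.I * (starRingEnd ℂ) (uhpSqrt (x + p)) *
    (starRingEnd ℂ) (uhpSqrt (x - p))) * Complex.I_sq

theorem halfWave_ofReal_of_abs_le {x : ℝ} (hx : |x| ≤ p) :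
    halfWave p x = (√(p ^ 2 - x ^ 2) : ℝ) + Complex.I * x := by
  rw [abs_le] at hx
  have h1 : uhpSqrt (x - p) = Complex.I * √(p - x) := by
    have := uhpSqrt_ofReal_of_nonpos (x := x - p) (by linarith)
    push_cast at this
    rw [this, neg_sub]
  have h2 : uhpSqrt (x + p) = √(x + p) := by
    have := uhpSqrt_ofReal_of_nonneg (x := x + p) (by linarith)
    push_cast at this
    exact this
  have h3 : √(p ^ 2 - x ^ 2) = √(p - x) * √(x + p) := by
    rw [← Real.sqrt_mul (by linarith)]
    congr 1
    ring
  unfold halfWave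
  rw [h1, h2, h3]
  push_cast
  linear_combination (-(√(p - x) : ℂ) * √(x + p)) * Complex.I_sq

theorem halfWave_ofReal_of_le {x : ℝ} (hp : 0 ≤ p) (hx : p ≤ x) :
    halfWave p x = Complex.I * (x - √(x ^ 2 - p ^ 2) : ℝ) := by
  have h1 : uhpSqrt (x - p) = √(x - p) := by
    have := uhpSqrt_ofReal_of_nonneg (x := x - p) (by linarith)
    push_cast at this
    exact this
  have h2 : uhpSqrt (x + p) = √(x + p) := by
    have := uhpSqrt_ofReal_of_nonneg (x := x + p) (by linarith)
    push_cast at this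
    exact this
  have h3 : √(x ^ 2 - p ^ 2) = √(x - p) * √(x + p) := by
    rw [← Real.sqrt_mul (by linarith)]
    congr 1
    ring
  unfold halfWave
  rw [h1, h2, h3]
  push_cast
  ring

theorem conj_halfWave_of_le {x : ℝ} (hp : 0 ≤ p) (hx : p ≤ x) :
    (starRingEnd ℂ) (halfWave p x) = -halfWave p x := by
  rw [halfWave_ofReal_of_le hp hx]
  simp

end HalfWave

/-- The spectral density coupling the two half lines. -/
noncomputable def waveDensity (p q : ℝ) (m n : ℕ) (ν : ℂ) : ℂ :=
  (halfWave p ν / p) ^ (2 * m) * (halfWave q ν / q) ^ (2 * n) / (halfWave p ν + halfWave q ν)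

section WaveDensity

variable {p q : ℝ} {m n : ℕ}

theorem waveDensity_swap (p q : ℝ) (m n : ℕ) : waveDensity p q m n = waveDensity q p n m := by
  ext ν
  unfold waveDensity
  rw [add_comm, mul_comm]

theorem continuousOn_waveDensity (hp : 0 < p) (hq : 0 < q) (m n : ℕ) :
    ContinuousOn (waveDensity p q m n) {ν | 0 ≤ ν.im} := by
  have h1 := continuous_halfWave p
  have h2 := continuous_halfWave q
  unfold waveDensity
  exact ContinuousOn.div (by fun_prop) (by fun_prop) fun ν hν => halfWave_add_ne_zero hp hq hν

theorem differentiableAt_waveDensity (hp : 0 < p) (hq : 0 < q) (m n : ℕ) {ν : ℂ} (hν : 0 < ν.im) :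
    DifferentiableAt ℂ (waveDensity p q m n) ν := by
  have h1 := differentiableAt_halfWave (p := p) hν
  have h2 := differentiableAt_halfWave (p := q) hν
  have h3 := halfWave_add_ne_zero hp hq hν.le
  unfold waveDensity
  fun_prop (disch := assumption)

theorem continuous_waveDensity_ofReal (hp : 0 < p) (hq : 0 < q) (m n : ℕ) :
    Continuous fun x : ℝ => waveDensity p q m n x :=
  (continuousOn_waveDensity hp hq m n).comp_continuous Complex.continuous_ofReal fun x => by simp

theorem waveDensity_neg_ofReal (p q : ℝ) (m n : ℕ) (x : ℝ) :
    waveDensity p q m n (-x) = (starRingEnd ℂ) (waveDensity p q m n x) := by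
  simp only [waveDensity, halfWave_neg_ofReal, map_mul, map_div₀, map_pow, map_add,
    Complex.conj_ofReal]

theorem waveDensity_neg_of_le (hp : 0 < p) (hq : 0 < q) (m n : ℕ) {x : ℝ} (hpx : p ≤ x)
    (hqx : q ≤ x) : waveDensity p q m n (-x) = -waveDensity p q m n x := by
  simp only [waveDensity, halfWave_neg_ofReal, conj_halfWave_of_le hp.le hpx,
    conj_halfWave_of_le hq.le hqx, neg_div, Even.neg_pow (even_two_mul _)]
  rw [← neg_add, div_neg]

theorem norm_waveDensity_le (hp : 0 < p) (hq : 0 < q) (hmn : 2 ≤ m + n) {ν : ℂ} (hν : 0 ≤ ν.im)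
    (hN : 2 * (p ^ 2 + q ^ 2) ≤ ‖ν‖ ^ 2) :
    ‖waveDensity p q m n ν‖ ≤ 4 * (p ^ 2 + q ^ 2) / ‖ν‖ ^ 3 := by
  have hpos : 0 < p ^ 2 + q ^ 2 := by positivity
  have hν2 : 0 < ‖ν‖ ^ 2 := by linarith
  have hν0 : 0 < ‖ν‖ := by
    rcases (norm_nonneg ν).eq_or_lt with h | h
    · rw [← h] at hν2; norm_num at hν2
    · exact h
  set r := (p ^ 2 + q ^ 2) / ‖ν‖ ^ 2 with hr
  have hr0 : 0 ≤ r := by positivity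
  have hr1 : r ≤ 1 := by rw [hr, div_le_one hν2]; linarith
  have hb : ∀ s : ℝ, 0 < s → s ^ 2 ≤ p ^ 2 + q ^ 2 → ‖(halfWave s ν / s) ^ 2‖ ≤ r := by
    intro s hs hsle
    have := norm_halfWave_mul_le (p := s) hν
    have h1 : ‖halfWave s ν / s‖ ≤ s / ‖ν‖ := by
      rw [norm_div, Complex.norm_real, Real.norm_of_nonneg hs.le, div_le_div_iff₀ hs hν0]
      linarith
    rw [norm_pow]
    calc _ ≤ (s / ‖ν‖) ^ 2 := by gcongr
      _ = s ^ 2 / ‖ν‖ ^ 2 := by ring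
      _ ≤ r := by rw [hr]; gcongr
  have h1 := hb p hp (by nlinarith)
  have h2 := hb q hq (by nlinarith)
  rw [waveDensity, div_eq_mul_inv, norm_mul, norm_mul, pow_mul, pow_mul, norm_pow _ m, norm_pow _ n]
  calc _ ≤ r ^ m * r ^ n * (4 * ‖ν‖ / (p ^ 2 + q ^ 2)) := by
        gcongr
        exact norm_inv_halfWave_add_le hp hq hν hN
    _ = r ^ (m + n) * (4 * ‖ν‖ / (p ^ 2 + q ^ 2)) := by rw [pow_add]
    _ ≤ r ^ 2 * (4 * ‖ν‖ / (p ^ 2 + q ^ 2)) := by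
        gcongr ?_ * _
        exact pow_le_pow_of_le_one hr0 hr1 hmn
    _ = _ := by
        rw [hr]
        field_simp

theorem integral_waveDensity_eq_of_le (hp : 0 < p) (hq : 0 < q) (m n : ℕ) {N R : ℝ} (hpN : p ≤ N)
    (hqN : q ≤ N) (hNR : N ≤ R) :
    ∫ x in (-R)..R, waveDensity p q m n (x : ℂ) = ∫ x in (-N)..N, waveDensity p q m n (x : ℂ) := by
  have hi : ∀ a b : ℝ, IntervalIntegrable (fun x : ℝ => waveDensity p q m n x) volume a b :=
    fun a b => (continuous_waveDensity_ofReal hp hq m n).intervalIntegrable a b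
  have h1 : ∫ x in (-R)..(-N), waveDensity p q m n (x : ℂ)
      = -∫ x in N..R, waveDensity p q m n (x : ℂ) := by
    rw [← intervalIntegral.integral_neg,
      ← intervalIntegral.integral_comp_neg (fun x : ℝ => waveDensity p q m n (x : ℂ))]
    refine intervalIntegral.integral_congr fun x hx => ?_
    rw [uIcc_of_le hNR] at hx
    simp only [Complex.ofReal_neg]
    exact waveDensity_neg_of_le hp hq m n (hpN.trans hx.1) (hqN.trans hx.1)
  rw [← intervalIntegral.integral_add_adjacent_intervals (hi (-R) (-N)) (hi (-N) R),
    ← intervalIntegral.integral_add_adjacent_intervals (hi (-N) N) (hi N R), h1]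
  ring

theorem integral_waveDensity_eq_zero (hp : 0 < p) (hq : 0 < q) (hmn : 2 ≤ m + n) {N : ℝ}
    (hpN : p ≤ N) (hqN : q ≤ N) : ∫ x in (-N)..N, waveDensity p q m n (x : ℂ) = 0 := by
  have hN0 : 0 < N := hp.trans_le hpN
  set c := 4 * (p ^ 2 + q ^ 2) with hc
  have hbound : ∀ R : ℝ, N ≤ R → 2 * (p ^ 2 + q ^ 2) ≤ R ^ 2 →
      ‖∫ x in (-N)..N, waveDensity p q m n (x : ℂ)‖ ≤ 4 * c / R ^ 2 := by
    intro R hNR hR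
    have hR0 : 0 < R := hN0.trans_le hNR
    have hf : ∀ ν : ℂ, 0 ≤ ν.im → R ≤ ‖ν‖ → ‖waveDensity p q m n ν‖ ≤ c / R ^ 3 := by
      intro ν hν hRν
      refine (norm_waveDensity_le hp hq hmn hν (hR.trans (by gcongr))).trans ?_
      gcongr
    have hrect := Complex.integral_boundary_rect_eq_zero_of_continuousOn_of_differentiableOn
      (waveDensity p q m n) (-R : ℝ) ((R : ℝ) + (R : ℝ) * Complex.I)
      ((continuousOn_waveDensity hp hq m n).mono (by
        intro z hz
        have := hz.2
        simp [uIcc_of_le hR0.le] at this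
        exact this.1))
      (by
        intro z hz
        have := hz.2
        simp [hR0.le] at this
        exact (differentiableAt_waveDensity hp hq m n this.1).differentiableWithinAt)
    simp only [Complex.add_re, Complex.ofReal_re, Complex.mul_re, Complex.I_re, mul_zero,
      Complex.ofReal_im, Complex.I_im, mul_one, sub_self, add_zero, Complex.add_im,
      Complex.mul_im, zero_add, zero_mul, Complex.ofReal_zero, smul_eq_mul] at hrect
    rw [← integral_waveDensity_eq_of_le hp hq m n hpN hqN hNR]
    have htop : ‖∫ x in (-R)..R, waveDensity p q m n (x + R * Complex.I)‖
        ≤ c / R ^ 3 * |R - -R| := by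
      refine intervalIntegral.norm_integral_le_of_norm_le_const fun x _ => hf _ (by simp [hR0.le]) ?_
      refine le_trans ?_ (Complex.abs_im_le_norm _)
      simp [abs_of_pos hR0]
    have hside : ∀ r : ℝ, |r| = R → ‖∫ y in (0 : ℝ)..R, waveDensity p q m n (r + y * Complex.I)‖
        ≤ c / R ^ 3 * |R - 0| := by
      intro r hr
      refine intervalIntegral.norm_integral_le_of_norm_le_const fun y hy => hf _ ?_ ?_
      · rw [uIoc_of_le hR0.le] at hy
        simpa using hy.1.le
      · refine le_trans ?_ (Complex.abs_re_le_norm _)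
        simp [hr]
    have hs1 := hside R (abs_of_pos hR0)
    have hs2 := hside (-R) (by rw [abs_neg, abs_of_pos hR0])
    have e : ∫ x in (-R)..R, waveDensity p q m n (x : ℂ)
        = (∫ x in (-R)..R, waveDensity p q m n (x + R * Complex.I))
          - Complex.I * (∫ y in (0 : ℝ)..R, waveDensity p q m n (R + y * Complex.I))
          + Complex.I * ∫ y in (0 : ℝ)..R, waveDensity p q m n ((-R : ℝ) + y * Complex.I) := by
      linear_combination hrect
    rw [e]
    refine (norm_add_le _ _).trans ((add_le_add_left (norm_sub_le _ _) _).trans ?_)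
    rw [norm_mul, norm_mul, Complex.norm_I, one_mul, one_mul]
    refine (add_le_add (add_le_add htop hs1) hs2).trans (le_of_eq ?_)
    rw [sub_zero, sub_neg_eq_add, abs_of_pos hR0, abs_of_pos (by linarith)]
    field_simp
    ring
  have hlim : Filter.Tendsto (fun R : ℝ => 4 * c / R ^ 2) Filter.atTop (nhds 0) :=
    tendsto_const_nhds.div_atTop (Filter.tendsto_pow_atTop two_ne_zero)
  have hle := ge_of_tendsto hlim (b := ‖∫ x in (-N)..N, waveDensity p q m n (x : ℂ)‖) (by
    filter_upwards [Filter.eventually_ge_atTop N,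
      (Filter.tendsto_pow_atTop (α := ℝ) two_ne_zero).eventually_ge_atTop (2 * (p ^ 2 + q ^ 2))]
      with R h1 h2
    exact hbound R h1 h2)
  exact norm_le_zero_iff.1 hle

end WaveDensity

/-- The oscillatory integral `∫ e^{-itg(x)} h(x) dx`. -/
noncomputable def oscIntegral (g : ℝ → ℝ) (h : ℝ → ℂ) (a b t : ℝ) : ℂ :=
  ∫ x in a..b, Complex.exp (-(t * g x : ℝ) * Complex.I) * h x

theorem hasDerivAt_oscIntegral {g : ℝ → ℝ} {h : ℝ → ℂ} (hg : Continuous g) (hh : Continuous h)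
    (a b t : ℝ) :
    HasDerivAt (oscIntegral g h a b)
      (oscIntegral g (fun x => -(g x : ℂ) * Complex.I * h x) a b t) t := by
  have hgc : Continuous fun x => (g x : ℂ) := Complex.continuous_ofReal.comp hg
  refine (intervalIntegral.hasDerivAt_integral_of_dominated_loc_of_deriv_le
    (F := fun (t x : ℝ) => Complex.exp (-(t * g x : ℝ) * Complex.I) * h x)
    (F' := fun (t x : ℝ) => Complex.exp (-(t * g x : ℝ) * Complex.I) * (-(g x : ℂ) * Complex.I * h x))
    (bound := fun x => ‖g x‖ * ‖h x‖) (s := univ) Filter.univ_mem ?_ ?_ ?_ ?_ ?_ ?_).2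
  · exact Filter.Eventually.of_forall fun s => (by fun_prop : Continuous _).aestronglyMeasurable
  · exact (by fun_prop : Continuous _).intervalIntegrable _ _
  · exact (by fun_prop : Continuous _).aestronglyMeasurable
  · refine Filter.Eventually.of_forall fun x _ s _ => le_of_eq ?_
    rw [← Complex.ofReal_neg, norm_mul, Complex.norm_exp_ofReal_mul_I, one_mul, norm_mul, norm_mul,
      norm_neg, Complex.norm_I, mul_one, Complex.norm_real]
  · exact (by fun_prop : Continuous _).intervalIntegrable _ _
  · refine Filter.Eventually.of_forall fun x _ s _ => ?_
    have h1 : HasDerivAt (fun s : ℝ => -((s * g x : ℝ) : ℂ)) (-((1 * g x : ℝ) : ℂ)) s :=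
      (((hasDerivAt_id s).mul_const (g x)).ofReal_comp).neg
    refine ((h1.mul_const Complex.I).cexp.mul_const (h x)).congr_deriv ?_
    push_cast
    ring

theorem oscIntegral_const_mul (g : ℝ → ℝ) (h : ℝ → ℂ) (c : ℂ) (a b t : ℝ) :
    oscIntegral g (fun x => c * h x) a b t = c * oscIntegral g h a b t := by
  unfold oscIntegral
  rw [← intervalIntegral.integral_const_mul]
  congr 1
  ext x
  ring

theorem oscIntegral_add {g : ℝ → ℝ} {h k : ℝ → ℂ} (hg : Continuous g) (hh : Continuous h)
    (hk : Continuous k) (a b t : ℝ) :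
    oscIntegral g (fun x => h x + k x) a b t = oscIntegral g h a b t + oscIntegral g k a b t := by
  have hgc : Continuous fun x => (g x : ℂ) := Complex.continuous_ofReal.comp hg
  unfold oscIntegral
  rw [← intervalIntegral.integral_add]
  · simp only [mul_add]
  · exact (by fun_prop : Continuous _).intervalIntegrable _ _
  · exact (by fun_prop : Continuous _).intervalIntegrable _ _

/-- If `-g h_1` is a multiple of the second difference of `h`, the oscillatory integrals solve the
discrete Schrödinger equation. -/
theorem hasDerivAt_oscIntegral_of_second_difference {g : ℝ → ℝ} {h₀ h₁ h₂ : ℝ → ℂ} {α : ℝ}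
    (hg : Continuous g) (hh₀ : Continuous h₀) (hh₁ : Continuous h₁) (hh₂ : Continuous h₂)
    (he : ∀ x, -(g x : ℂ) * h₁ x = α * (h₂ x - 2 * h₁ x + h₀ x)) (a b t : ℝ) :
    HasDerivAt (oscIntegral g h₁ a b) (Complex.I * (α * (oscIntegral g h₂ a b t
      - 2 * oscIntegral g h₁ a b t + oscIntegral g h₀ a b t))) t := by
  refine (hasDerivAt_oscIntegral hg hh₁ a b t).congr_deriv ?_
  have e : (fun x => -(g x : ℂ) * Complex.I * h₁ x)
      = fun x => (Complex.I * α) * (h₂ x + ((-2) * h₁ x + h₀ x)) := by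
    ext x
    linear_combination Complex.I * he x
  rw [e, oscIntegral_const_mul, oscIntegral_add hg hh₂ (by fun_prop),
    oscIntegral_add hg (by fun_prop) hh₀, oscIntegral_const_mul]
  ring

/-- The oscillatory integral describing the interaction of the half lines. -/
noncomputable def couplingIntegral (p q : ℝ) (m n : ℕ) : ℝ → ℂ :=
  oscIntegral (fun x => 4 * x ^ 2) (fun x => waveDensity p q m n x) (-max p q) (max p q)

/-- The fundamental solution of the half line with Dirichlet condition, up to a factor. -/
noncomputable def sineKernel (q : ℝ) (n k : ℕ) : ℝ → ℂ :=
  oscIntegral (fun x => q ^ 2 * (2 - 2 * Real.cos x))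
    (fun x => ((Real.sin (n * x) * Real.sin (k * x) : ℝ) : ℂ)) 0 Real.pi

theorem couplingIntegral_swap (p q : ℝ) (m n : ℕ) :
    couplingIntegral p q m n = couplingIntegral q p n m := by
  unfold couplingIntegral
  rw [max_comm, waveDensity_swap]

theorem hasDerivAt_couplingIntegral_left {p q : ℝ} (hp : 0 < p) (hq : 0 < q) (m n : ℕ) (t : ℝ) :
    HasDerivAt (couplingIntegral p q (m + 1) n)
      (Complex.I * ((p ^ 2 : ℝ) * (couplingIntegral p q (m + 2) n t
        - 2 * couplingIntegral p q (m + 1) n t + couplingIntegral p q m n t))) t := by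
  refine hasDerivAt_oscIntegral_of_second_difference (by fun_prop)
    (continuous_waveDensity_ofReal hp hq m n) (continuous_waveDensity_ofReal hp hq (m + 1) n)
    (continuous_waveDensity_ofReal hp hq (m + 2) n) (fun x => ?_) _ _ t
  have hp' : (p : ℂ) ≠ 0 := by exact_mod_cast hp.ne'
  have hs := halfWave_sq (p := p) (ν := x) (by simp)
  unfold waveDensity
  set s := halfWave p x
  set w := (s / p) ^ 2 with hw
  have hw1 : p ^ 2 * (w ^ 2 - 2 * w + 1) = -(4 * x ^ 2) * w := by
    have e : w * p ^ 2 = s ^ 2 := by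
      rw [hw]
      field_simp
    have h2 : p ^ 2 * (p ^ 2 * (w ^ 2 - 2 * w + 1)) = p ^ 2 * (-(4 * x ^ 2) * w) := by
      linear_combination (w * p ^ 2 + s ^ 2 - 2 * p ^ 2 + 4 * x ^ 2) * e
        + (s ^ 2 - p ^ 2 + 2 * Complex.I * x * s) * hs + 4 * x ^ 2 * s ^ 2 * Complex.I_sq
    exact mul_left_cancel₀ (pow_ne_zero 2 hp') h2
  simp only [pow_mul, ← hw, pow_succ w]
  push_cast
  linear_combination (-w ^ m * ((halfWave q x / q) ^ 2) ^ n / (s + halfWave q x)) * hw1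

theorem hasDerivAt_couplingIntegral_right {p q : ℝ} (hp : 0 < p) (hq : 0 < q) (m n : ℕ) (t : ℝ) :
    HasDerivAt (couplingIntegral p q m (n + 1))
      (Complex.I * ((q ^ 2 : ℝ) * (couplingIntegral p q m (n + 2) t
        - 2 * couplingIntegral p q m (n + 1) t + couplingIntegral p q m n t))) t := by
  simp only [couplingIntegral_swap p q m]
  exact hasDerivAt_couplingIntegral_left hq hp n m t

theorem hasDerivAt_sineKernel (q : ℝ) (n k : ℕ) (t : ℝ) :
    HasDerivAt (sineKernel q (n + 1) k)
      (Complex.I * ((q ^ 2 : ℝ) * (sineKernel q (n + 2) k t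
        - 2 * sineKernel q (n + 1) k t + sineKernel q n k t))) t := by
  refine hasDerivAt_oscIntegral_of_second_difference (by fun_prop) (by fun_prop) (by fun_prop)
    (by fun_prop) (fun x => ?_) _ _ t
  have h2 : Real.sin ((n + 2 : ℕ) * x) + Real.sin (n * x)
      = 2 * Real.cos x * Real.sin ((n + 1 : ℕ) * x) := by
    have e1 : ((n + 2 : ℕ) : ℝ) * x = (n + 1 : ℕ) * x + x := by push_cast; ring
    have e2 : (n : ℝ) * x = (n + 1 : ℕ) * x - x := by push_cast; ring
    rw [e1, e2, Real.sin_add, Real.sin_sub]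
    ring
  have h3 : -(q ^ 2 * (2 - 2 * Real.cos x)) * (Real.sin ((n + 1 : ℕ) * x) * Real.sin (k * x))
      = q ^ 2 * (Real.sin ((n + 2 : ℕ) * x) * Real.sin (k * x)
        - 2 * (Real.sin ((n + 1 : ℕ) * x) * Real.sin (k * x)) + Real.sin (n * x) * Real.sin (k * x)) := by
    linear_combination -q ^ 2 * Real.sin (k * x) * h2
  exact_mod_cast h3

theorem couplingIntegral_zero {p q : ℝ} (hp : 0 < p) (hq : 0 < q) {m n : ℕ} (hmn : 2 ≤ m + n) :
    couplingIntegral p q m n 0 = 0 := by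
  have := integral_waveDensity_eq_zero hp hq hmn (le_max_left p q) (le_max_right p q)
  unfold couplingIntegral oscIntegral
  simpa using this

theorem integral_cos_nat_mul (n : ℕ) :
    ∫ x in (0 : ℝ)..Real.pi, Real.cos (n * x) = if n = 0 then Real.pi else 0 := by
  split_ifs with h
  · simp [h]
  · have hn : (n : ℝ) ≠ 0 := by exact_mod_cast h
    rw [intervalIntegral.integral_comp_mul_left (fun x => Real.cos x) hn, integral_cos]
    simp [Real.sin_nat_mul_pi]

theorem sineKernel_zero (q : ℝ) (n k : ℕ) :
    sineKernel q n (k + 1) 0 = if n = k + 1 then (Real.pi / 2 : ℂ) else 0 := by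
  have key : ∀ a b : ℕ, ∫ x in (0 : ℝ)..Real.pi, Real.sin ((a + b : ℕ) * x) * Real.sin (a * x)
      = ((if b = 0 then Real.pi else 0) - if 2 * a + b = 0 then Real.pi else 0) / 2 := by
    intro a b
    rw [← integral_cos_nat_mul, ← integral_cos_nat_mul, ← intervalIntegral.integral_sub
      ((by fun_prop : Continuous _).intervalIntegrable _ _)
      ((by fun_prop : Continuous _).intervalIntegrable _ _), ← intervalIntegral.integral_div]
    congr 1
    ext x
    have e1 : (b : ℝ) * x = (a + b : ℕ) * x - a * x := by push_cast; ring
    have e2 : ((2 * a + b : ℕ) : ℝ) * x = (a + b : ℕ) * x + a * x := by push_cast; ring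
    rw [e1, e2, Real.cos_sub, Real.cos_add]
    ring
  have hreal : ∫ x in (0 : ℝ)..Real.pi, Real.sin (n * x) * Real.sin ((k + 1 : ℕ) * x)
      = if n = k + 1 then Real.pi / 2 else 0 := by
    rcases le_total n (k + 1) with h | h
    · obtain ⟨b, hb⟩ := Nat.exists_eq_add_of_le h
      simp_rw [hb, mul_comm (Real.sin (n * _)), key]
      by_cases hb0 : b = 0
      · subst hb0
        have : n ≠ 0 := by omega
        simp [this]
      · simp [hb0]
    · obtain ⟨b, rfl⟩ := Nat.exists_eq_add_of_le h
      rw [key]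
      by_cases hb0 : b = 0 <;> simp [hb0]
  unfold sineKernel oscIntegral
  simp only [zero_mul, Complex.ofReal_zero, neg_zero, Complex.exp_zero, one_mul]
  rw [intervalIntegral.integral_ofReal, hreal]
  split_ifs <;> simp

/-- The flux created at the node `0` by the coupling integrals cancels that of the sine kernel. -/
theorem integral_halfWave_pow_mul_eq {q N : ℝ} (hq : 0 < q) (hqN : q ≤ N) (k : ℕ) (t : ℝ) :
    oscIntegral (fun x => 4 * x ^ 2)
      (fun x => (halfWave q x / q) ^ (2 * k) * (2 * Complex.I * x)) (-N) N t
      = -(q ^ 2 : ℝ) * oscIntegral (fun x => q ^ 2 * (2 - 2 * Real.cos x))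
        (fun x => ((Real.sin x * Real.sin (k * x) : ℝ) : ℂ)) 0 Real.pi t := by
  have hq' : (q : ℂ) ≠ 0 := by exact_mod_cast hq.ne'
  have hhw : Continuous fun x : ℝ => halfWave q x :=
    (continuous_halfWave q).comp Complex.continuous_ofReal
  set A : ℝ → ℂ := fun x => Complex.exp (-(t * (4 * x ^ 2) : ℝ) * Complex.I) *
    ((halfWave q x / q) ^ (2 * k) * (2 * Complex.I * x)) with hA
  have hAc : Continuous A := by fun_prop
  have hi : ∀ a b, IntervalIntegrable A volume a b := fun a b => hAc.intervalIntegrable a b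
  have hAn : Continuous fun x => A (-x) := hAc.comp continuous_neg
  have hG : Continuous fun x => A x + A (-x) := hAc.add hAn
  have hodd : ∀ x, A x + A (-x) = Complex.exp (-(t * (4 * x ^ 2) : ℝ) * Complex.I) *
      (2 * Complex.I * x) * ((halfWave q x / q) ^ (2 * k)
        - (starRingEnd ℂ) ((halfWave q x / q) ^ (2 * k))) := fun x => by
    simp only [hA, Complex.ofReal_neg, halfWave_neg_ofReal, neg_sq, map_pow, map_div₀,
      Complex.conj_ofReal]
    ring
  have h1 : ∫ x in (-N)..N, A x = ∫ x in (0 : ℝ)..q, (A x + A (-x)) := by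
    rw [← intervalIntegral.integral_add_adjacent_intervals (hi (-N) 0) (hi 0 N)]
    have : ∫ x in (-N)..0, A x = ∫ x in (0 : ℝ)..N, A (-x) := by
      rw [intervalIntegral.integral_comp_neg, neg_zero]
    rw [this, add_comm, ← intervalIntegral.integral_add (hi 0 N) (hAn.intervalIntegrable _ _),
      ← intervalIntegral.integral_add_adjacent_intervals (hG.intervalIntegrable 0 q)
        (hG.intervalIntegrable q N)]
    have hz : ∫ x in q..N, (A x + A (-x)) = ∫ x in q..N, (0 : ℂ) := by
      refine intervalIntegral.integral_congr fun x hx => ?_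
      rw [uIcc_of_le hqN] at hx
      simp only [hodd, map_pow, map_div₀, Complex.conj_ofReal, conj_halfWave_of_le hq.le hx.1,
        neg_div, Even.neg_pow (even_two_mul _), sub_self, mul_zero]
    rw [hz]
    simp
  have hsub := intervalIntegral.integral_deriv_smul_comp (a := 0) (b := Real.pi)
    (f := fun θ => q * Real.sin (θ / 2)) (f' := fun θ => q * Real.cos (θ / 2) / 2)
    (g := fun x => A x + A (-x)) (fun θ _ => by
      refine ((((hasDerivAt_id θ).div_const 2).sin).const_mul q).congr_deriv ?_
      simp only [id]
      ring) (by fun_prop) hG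
  simp only [zero_div, Real.sin_zero, mul_zero, Real.sin_pi_div_two, mul_one] at hsub
  unfold oscIntegral
  rw [h1, ← hsub, ← intervalIntegral.integral_const_mul]
  refine intervalIntegral.integral_congr fun θ hθ => ?_
  rw [uIcc_of_le Real.pi_pos.le] at hθ
  have hc0 : 0 ≤ Real.cos (θ / 2) :=
    Real.cos_nonneg_of_mem_Icc ⟨by linarith [hθ.1, Real.pi_pos], by linarith [hθ.2]⟩
  have hw : halfWave q (q * Real.sin (θ / 2) : ℝ) / q = Complex.exp ((θ / 2 : ℝ) * Complex.I) := by
    have habs : |q * Real.sin (θ / 2)| ≤ q := by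
      rw [abs_mul, abs_of_pos hq]
      nlinarith [Real.abs_sin_le_one (θ / 2)]
    have e : q ^ 2 - (q * Real.sin (θ / 2)) ^ 2 = (q * Real.cos (θ / 2)) ^ 2 := by
      have := Real.sin_sq_add_cos_sq (θ / 2)
      linear_combination -q ^ 2 * this
    rw [halfWave_ofReal_of_abs_le habs, e, Real.sqrt_sq (by positivity), Complex.exp_mul_I,
      div_eq_iff hq', ← Complex.ofReal_cos, ← Complex.ofReal_sin]
    push_cast
    ring
  have hw2 : (halfWave q (q * Real.sin (θ / 2) : ℝ) / q) ^ (2 * k)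
      = Real.cos (k * θ) + Real.sin (k * θ) * Complex.I := by
    have e : ((2 * k : ℕ) : ℂ) * ((θ / 2 : ℝ) * Complex.I) = (k * θ : ℝ) * Complex.I := by
      push_cast
      ring
    rw [hw, ← Complex.exp_nat_mul, e, Complex.exp_mul_I, Complex.ofReal_cos, Complex.ofReal_sin]
  have hph : 4 * (q * Real.sin (θ / 2)) ^ 2 = q ^ 2 * (2 - 2 * Real.cos θ) := by
    have e : θ = 2 * (θ / 2) := by ring
    have h := Real.cos_two_mul (θ / 2)
    rw [← e] at h
    have := Real.sin_sq_add_cos_sq (θ / 2)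
    rw [h]
    linear_combination 4 * q ^ 2 * this
  have hsin : (Real.sin θ : ℂ) = 2 * Real.sin (θ / 2) * Real.cos (θ / 2) := by
    have e : θ = 2 * (θ / 2) := by ring
    have h := Real.sin_two_mul (θ / 2)
    rw [← e] at h
    exact_mod_cast h
  simp only [Function.comp_apply, hodd, hw2, hph, Complex.real_smul, map_add, map_mul,
    Complex.conj_ofReal, Complex.conj_I]
  push_cast
  rw [← Complex.ofReal_sin θ, hsin]
  push_cast
  linear_combination (2 * (q : ℂ) ^ 2 * Complex.cos (θ / 2) * Complex.sin (θ / 2) *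
    Complex.sin (k * θ) * Complex.exp (-(t * (q ^ 2 * (2 - 2 * Complex.cos θ))) * Complex.I))
    * Complex.I_sq

/-- A solution of the coupled system in terms of the distances to the node `0`. -/
structure IsHalfLinePair (α β : ℝ) (x y : ℝ → ℕ → ℂ) : Prop where
  left : ∀ t m, HasDerivAt (fun s => x s (m + 1))
    (Complex.I * (α * (x t (m + 2) - 2 * x t (m + 1) + x t m))) t
  right : ∀ t n, HasDerivAt (fun s => y s (n + 1))
    (Complex.I * (β * (y t (n + 2) - 2 * y t (n + 1) + y t n))) t
  node : ∀ t, x t 0 = y t 0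
  flux : ∀ t, α * (x t 1 - x t 0) + β * (y t 1 - y t 0) = 0

theorem IsHalfLinePair.symm {α β : ℝ} {x y : ℝ → ℕ → ℂ} (h : IsHalfLinePair α β x y) :
    IsHalfLinePair β α y x :=
  ⟨h.right, h.left, fun t => (h.node t).symm, fun t => by rw [add_comm]; exact h.flux t⟩

/-- The sequence on `ℤ \ {0}` assembled from two half-line sequences. -/
def glue (x y : ℝ → ℕ → ℂ) (t : ℝ) (j : ZStar) : ℂ :=
  if j.1 < 0 then x t j.1.natAbs else y t j.1.natAbs

theorem IsHalfLinePair.hasDerivAt_glue {α β : ℝ} (hα : 0 < α) (hβ : 0 < β) {x y : ℝ → ℕ → ℂ}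
    (h : IsHalfLinePair α β x y) (t : ℝ) (j : ZStar) :
    HasDerivAt (fun s => glue x y s j) (Complex.I * coupledLaplacian α β (glue x y t) j) t := by
  have hs : (α + β : ℂ) ≠ 0 := by
    have : α + β ≠ 0 := by positivity
    exact_mod_cast this
  have ha : interfaceValue α β (glue x y t) = x t 0 := by
    have e1 : glue x y t ⟨-1, by decide⟩ = x t 1 := by simp [glue]
    have e2 : glue x y t ⟨1, by decide⟩ = y t 1 := by simp [glue]
    rw [interfaceValue, div_eq_iff hs, e1, e2]
    linear_combination h.flux t - β * h.node t
  have hE1 : ∀ m : ℕ, extendAtZero (glue x y t) (x t 0) (-(m : ℤ)) = x t m := by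
    intro m
    unfold extendAtZero glue
    rcases Nat.eq_zero_or_pos m with rfl | hm
    · simp
    · have h1 : -(m : ℤ) ≠ 0 := by omega
      have h2 : -(m : ℤ) < 0 := by omega
      rw [dif_neg h1, if_pos h2]
      simp
  have hE2 : ∀ m : ℕ, extendAtZero (glue x y t) (x t 0) (m : ℤ) = y t m := by
    intro m
    unfold extendAtZero glue
    rcases Nat.eq_zero_or_pos m with rfl | hm
    · simp [h.node]
    · have h1 : (m : ℤ) ≠ 0 := by omega
      have h2 : ¬ (m : ℤ) < 0 := by omega
      rw [dif_neg h1, if_neg h2]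
      simp
  obtain ⟨j, hj⟩ := j
  unfold coupledLaplacian discreteLaplacian
  rw [ha]
  rcases lt_or_gt_of_ne hj with hneg | hpos
  · obtain ⟨m, rfl⟩ : ∃ m : ℕ, j = -((m + 1 : ℕ) : ℤ) := ⟨(-j - 1).toNat, by omega⟩
    have e1 : -((m + 1 : ℕ) : ℤ) + 1 = -(m : ℤ) := by push_cast; ring
    have e2 : -((m + 1 : ℕ) : ℤ) - 1 = -((m + 2 : ℕ) : ℤ) := by push_cast; ring
    simp only [glue, if_pos hneg, e1, e2, hE1, Int.natAbs_neg, Int.natAbs_natCast]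
    exact (h.left t m).congr_deriv (by ring)
  · obtain ⟨m, rfl⟩ : ∃ m : ℕ, j = ((m + 1 : ℕ) : ℤ) := ⟨(j - 1).toNat, by omega⟩
    have e1 : ((m + 1 : ℕ) : ℤ) + 1 = ((m + 2 : ℕ) : ℤ) := by push_cast; ring
    have e2 : ((m + 1 : ℕ) : ℤ) - 1 = (m : ℤ) := by push_cast; ring
    simp only [glue, if_neg (not_lt.2 hpos.le), e1, e2, hE2, Int.natAbs_natCast]
    exact (h.right t m).congr_deriv (by ring)

/-- The column of the fundamental solution with source at distance `k` on the `q` side, read on the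
other side. -/
noncomputable def transmittedColumn (p q : ℝ) (k : ℕ) (t : ℝ) (m : ℕ) : ℂ :=
  2 / Real.pi * couplingIntegral p q m k t

/-- The column of the fundamental solution with source at distance `k` on the `q` side, read on the
same side. -/
noncomputable def reflectedColumn (p q : ℝ) (k : ℕ) (t : ℝ) (n : ℕ) : ℂ :=
  2 / Real.pi * (couplingIntegral p q 0 (n + k) t + sineKernel q n k t)

theorem isHalfLinePair_column {p q : ℝ} (hp : 0 < p) (hq : 0 < q) (k : ℕ) :
    IsHalfLinePair (p ^ 2) (q ^ 2) (transmittedColumn p q k) (reflectedColumn p q k) where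
  left t m := by
    refine ((hasDerivAt_couplingIntegral_left hp hq m k t).const_mul (2 / Real.pi : ℂ)).congr_deriv ?_
    unfold transmittedColumn
    ring
  right t n := by
    have h1 := hasDerivAt_couplingIntegral_right hp hq 0 (n + k) t
    have h2 := hasDerivAt_sineKernel q n k t
    have e1 : n + 1 + k = n + k + 1 := by ring
    have e2 : n + 2 + k = n + k + 2 := by ring
    unfold reflectedColumn
    simp only [e1, e2]
    refine ((h1.add h2).const_mul (2 / Real.pi : ℂ)).congr_deriv ?_
    ring
  node t := by
    simp [transmittedColumn, reflectedColumn, sineKernel, oscIntegral]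
  flux t := by
    have hp' : (p : ℂ) ≠ 0 := by exact_mod_cast hp.ne'
    have hq' : (q : ℂ) ≠ 0 := by exact_mod_cast hq.ne'
    have hfl := integral_halfWave_pow_mul_eq hq (le_max_right p q) k t
    have hsine0 : sineKernel q 0 k t = 0 := by simp [sineKernel, oscIntegral]
    have hsine1 : sineKernel q 1 k t = oscIntegral (fun x => q ^ 2 * (2 - 2 * Real.cos x))
        (fun x => ((Real.sin x * Real.sin (k * x) : ℝ) : ℂ)) 0 Real.pi t := by
      simp [sineKernel]
    have hc := fun m n => continuous_waveDensity_ofReal hp hq m n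
    have hdens : (fun x : ℝ => (halfWave q x / q) ^ (2 * k) * (2 * Complex.I * x))
        = fun x : ℝ => (p ^ 2 : ℂ) * waveDensity p q 1 k x + (((-(p ^ 2 + q ^ 2) : ℂ))
          * waveDensity p q 0 k x + (q ^ 2 : ℂ) * waveDensity p q 0 (k + 1) x) := by
      ext x
      have hs := halfWave_sq (p := p) (ν := x) (by simp)
      have hr := halfWave_sq (p := q) (ν := x) (by simp)
      have hD := halfWave_add_ne_zero (ν := x) hp hq (by simp)
      unfold waveDensity
      have e1 : (halfWave p x / p) ^ 2 * p ^ 2 = halfWave p x ^ 2 := by field_simp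
      have e2 : (halfWave q x / q) ^ 2 * q ^ 2 = halfWave q x ^ 2 := by field_simp
      simp only [pow_mul, pow_succ _ k, pow_zero, pow_one, one_mul]
      set W := ((halfWave q x / q) ^ 2) ^ k
      rw [mul_div_assoc', mul_div_assoc', mul_div_assoc', ← add_div, ← add_div, eq_div_iff hD]
      linear_combination -W * (e1 + e2 + hs + hr)
    have hc' : Continuous fun x : ℝ => (-(p ^ 2 + q ^ 2) : ℂ) * waveDensity p q 0 k x
        + (q ^ 2 : ℂ) * waveDensity p q 0 (k + 1) x :=
      ((hc 0 k).const_mul _).add ((hc 0 (k + 1)).const_mul _)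
    rw [← hsine1, hdens, oscIntegral_add (by fun_prop) ((hc 1 k).const_mul _) hc',
      oscIntegral_add (by fun_prop) ((hc 0 k).const_mul _) ((hc 0 (k + 1)).const_mul _),
      oscIntegral_const_mul, oscIntegral_const_mul, oscIntegral_const_mul] at hfl
    simp only [transmittedColumn, reflectedColumn, zero_add, hsine0]
    rw [add_comm 1 k]
    unfold couplingIntegral
    push_cast at hfl ⊢
    linear_combination (2 / Real.pi : ℂ) * hfl

theorem isKernelColumn_of_decay {p q : ℝ} (hp : 0 < p) (hq : 0 < q) {C₁ C₂ C₃ : ℝ}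
    (h₁ : ∀ m n t, ‖couplingIntegral p q m n t‖ ≤ C₁ * (|t| + 1) ^ (-(1 / 3) : ℝ))
    (h₂ : ∀ n k t, ‖sineKernel p n k t‖ ≤ C₂ * (|t| + 1) ^ (-(1 / 3) : ℝ))
    (h₃ : ∀ n k t, ‖sineKernel q n k t‖ ≤ C₃ * (|t| + 1) ^ (-(1 / 3) : ℝ)) (k : ZStar) :
    ∃ K, IsKernelColumn (p ^ 2) (q ^ 2) k K ∧
      ∀ t j, ‖K t j‖ ≤ (C₁ + C₂ + C₃) * (|t| + 1) ^ (-(1 / 3) : ℝ) := by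
  have hC₁ : 0 ≤ C₁ := by simpa using (norm_nonneg _).trans (h₁ 0 0 0)
  have hC₂ : 0 ≤ C₂ := by simpa using (norm_nonneg _).trans (h₂ 0 0 0)
  have hC₃ : 0 ≤ C₃ := by simpa using (norm_nonneg _).trans (h₃ 0 0 0)
  have hpi : ‖(2 / Real.pi : ℂ)‖ ≤ 1 := by
    rw [norm_div, Complex.norm_two, Complex.norm_real, Real.norm_of_nonneg Real.pi_pos.le,
      div_le_one Real.pi_pos]
    exact Real.two_le_pi
  have hpi0 : (Real.pi : ℂ) ≠ 0 := by exact_mod_cast Real.pi_pos.ne'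
  have htr : ∀ (a b C : ℝ) (k m : ℕ) (t : ℝ), 0 ≤ C →
      (∀ m n t, ‖couplingIntegral a b m n t‖ ≤ C₁ * (|t| + 1) ^ (-(1 / 3) : ℝ)) →
      ‖transmittedColumn a b k t m‖ ≤ (C₁ + C) * (|t| + 1) ^ (-(1 / 3) : ℝ) := by
    intro a b C k m t hC h
    rw [transmittedColumn, norm_mul]
    have h1 := mul_le_mul hpi (h m k t) (norm_nonneg _) zero_le_one
    have h2 : 0 ≤ C * (|t| + 1) ^ (-(1 / 3) : ℝ) := by positivity
    linarith
  have hre : ∀ (a b C : ℝ) (k m : ℕ) (t : ℝ),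
      (∀ m n t, ‖couplingIntegral a b m n t‖ ≤ C₁ * (|t| + 1) ^ (-(1 / 3) : ℝ)) →
      (∀ n k t, ‖sineKernel b n k t‖ ≤ C * (|t| + 1) ^ (-(1 / 3) : ℝ)) →
      ‖reflectedColumn a b k t m‖ ≤ (C₁ + C) * (|t| + 1) ^ (-(1 / 3) : ℝ) := by
    intro a b C k m t h h'
    rw [reflectedColumn, norm_mul]
    have h1 := mul_le_mul hpi ((norm_add_le _ _).trans (add_le_add (h 0 (m + k) t) (h' m k t)))
      (norm_nonneg _) zero_le_one
    linarith
  have htr0 : ∀ (a b : ℝ) (k m : ℕ), 0 < a → 0 < b → 0 < k → 0 < m →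
      transmittedColumn a b k 0 m = 0 := by
    intro a b k m ha hb hk hm
    rw [transmittedColumn, couplingIntegral_zero ha hb (by omega), mul_zero]
  have hre0 : ∀ (a b : ℝ) (k m : ℕ), 0 < a → 0 < b → 0 < m →
      reflectedColumn a b (k + 1) 0 m = if m = k + 1 then 1 else 0 := by
    intro a b k m ha hb hm
    rw [reflectedColumn, couplingIntegral_zero ha hb (by omega), sineKernel_zero, zero_add]
    split_ifs
    · field_simp
    · simp
  have hle1 : ∀ t : ℝ, (|t| + 1) ^ (-(1 / 3) : ℝ) ≤ 1 := fun t =>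
    Real.rpow_le_one_of_one_le_of_nonpos (by linarith [abs_nonneg t]) (by norm_num)
  have hbd : ∀ K : ℝ → ZStar → ℂ,
      (∀ t j, ‖K t j‖ ≤ (C₁ + C₂ + C₃) * (|t| + 1) ^ (-(1 / 3) : ℝ)) → ∃ B, ∀ t j, ‖K t j‖ ≤ B :=
    fun K hK => ⟨C₁ + C₂ + C₃, fun t j => (hK t j).trans
      (mul_le_of_le_one_right (by positivity) (hle1 t))⟩
  have hr : ∀ t : ℝ, 0 ≤ (|t| + 1) ^ (-(1 / 3) : ℝ) := fun t => by positivity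
  have hswap : ∀ m n t, ‖couplingIntegral q p m n t‖ ≤ C₁ * (|t| + 1) ^ (-(1 / 3) : ℝ) :=
    fun m n t => by rw [couplingIntegral_swap]; exact h₁ n m t
  obtain ⟨k, hk⟩ := k
  rcases lt_or_gt_of_ne hk with hneg | hpos
  · obtain ⟨k, rfl⟩ : ∃ m : ℕ, k = -((m + 1 : ℕ) : ℤ) := ⟨(-k - 1).toNat, by omega⟩
    have hdec : ∀ t j, ‖glue (reflectedColumn q p (k + 1)) (transmittedColumn q p (k + 1)) t j‖
        ≤ (C₁ + C₂ + C₃) * (|t| + 1) ^ (-(1 / 3) : ℝ) := by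
      intro t j
      have := mul_nonneg hC₃ (hr t)
      unfold glue
      split_ifs
      · linarith [hre q p C₂ (k + 1) j.1.natAbs t hswap h₂]
      · linarith [htr q p C₂ (k + 1) j.1.natAbs t hC₂ hswap]
    refine ⟨_, ⟨(isHalfLinePair_column hq hp (k + 1)).symm.hasDerivAt_glue (by positivity)
      (by positivity), fun j => ?_, hbd _ hdec⟩, hdec⟩
    unfold glue
    obtain ⟨j, hj⟩ := j
    simp only [Pi.single_apply, Subtype.mk.injEq]
    split_ifs with h1 h2 h2
    · rw [hre0 q p k _ hq hp (by omega), if_pos (by omega)]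
    · rw [hre0 q p k _ hq hp (by omega), if_neg (by omega)]
    · omega
    · exact htr0 q p _ _ hq hp (by omega) (by omega)
  · obtain ⟨k, rfl⟩ : ∃ m : ℕ, k = ((m + 1 : ℕ) : ℤ) := ⟨(k - 1).toNat, by omega⟩
    have hdec : ∀ t j, ‖glue (transmittedColumn p q (k + 1)) (reflectedColumn p q (k + 1)) t j‖
        ≤ (C₁ + C₂ + C₃) * (|t| + 1) ^ (-(1 / 3) : ℝ) := by
      intro t j
      have := mul_nonneg hC₂ (hr t)
      unfold glue
      split_ifs
      · linarith [htr p q C₃ (k + 1) j.1.natAbs t hC₃ h₁]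
      · linarith [hre p q C₃ (k + 1) j.1.natAbs t h₁ h₃]
    refine ⟨_, ⟨(isHalfLinePair_column hp hq (k + 1)).hasDerivAt_glue (by positivity)
      (by positivity), fun j => ?_, hbd _ hdec⟩, hdec⟩
    unfold glue
    obtain ⟨j, hj⟩ := j
    simp only [Pi.single_apply, Subtype.mk.injEq]
    split_ifs with h1 h2 h2
    · omega
    · exact htr0 p q _ _ hp hq (by omega) (by omega)
    · rw [hre0 p q k _ hp hq (by omega), if_pos (by omega)]
    · rw [hre0 p q k _ hp hq (by omega), if_neg (by omega)]

theorem norm_le_mul_rpow_of_le {F : ℝ → ℂ} {A B : ℝ} (hA : ∀ t, ‖F t‖ ≤ A)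
    (hB : ∀ t, 1 ≤ |t| → ‖F t‖ ≤ B * |t| ^ (-(1 / 3) : ℝ)) (t : ℝ) :
    ‖F t‖ ≤ (2 * (A + B)) * (|t| + 1) ^ (-(1 / 3) : ℝ) := by
  have hA0 : 0 ≤ A := (norm_nonneg _).trans (hA 0)
  have hB0 : 0 ≤ B := by simpa using (norm_nonneg _).trans (hB 1 (by simp))
  have h2 : (1 / 2 : ℝ) ≤ 2 ^ (-(1 / 3) : ℝ) := by
    have : (2 : ℝ) ^ (-1 : ℝ) ≤ 2 ^ (-(1 / 3) : ℝ) :=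
      Real.rpow_le_rpow_of_exponent_le (by norm_num) (by norm_num)
    rw [Real.rpow_neg_one] at this
    linarith
  have hr : 0 ≤ (|t| + 1) ^ (-(1 / 3) : ℝ) := by positivity
  rcases le_total |t| 1 with h | h
  · have h1 : (2 : ℝ) ^ (-(1 / 3) : ℝ) ≤ (|t| + 1) ^ (-(1 / 3) : ℝ) :=
      Real.rpow_le_rpow_of_nonpos (by positivity) (by linarith) (by norm_num)
    nlinarith [hA t, mul_nonneg hB0 hr]
  · have h1 : (2 * |t|) ^ (-(1 / 3) : ℝ) ≤ (|t| + 1) ^ (-(1 / 3) : ℝ) :=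
      Real.rpow_le_rpow_of_nonpos (by positivity) (by linarith) (by norm_num)
    rw [Real.mul_rpow (by norm_num) (abs_nonneg t)] at h1
    have h3 : 0 ≤ |t| ^ (-(1 / 3) : ℝ) := by positivity
    have h4 : |t| ^ (-(1 / 3) : ℝ) ≤ 2 * (|t| + 1) ^ (-(1 / 3) : ℝ) := by nlinarith
    nlinarith [hB t h, mul_nonneg hA0 hr, mul_le_mul_of_nonneg_left h4 hB0]

theorem rpow_two_thirds_aux {t : ℝ} (ht : 0 < t) :
    0 < t ^ (2 / 3 : ℝ) ∧ √(t ^ (2 / 3 : ℝ)) = t ^ (1 / 3 : ℝ) ∧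
      t ^ (2 / 3 : ℝ) = t * t ^ (-(1 / 3) : ℝ) ∧ 1 / t ^ (1 / 3 : ℝ) = t ^ (-(1 / 3) : ℝ) := by
  refine ⟨by positivity, ?_, ?_, ?_⟩
  · rw [Real.sqrt_eq_rpow, ← Real.rpow_mul ht.le]
    norm_num
  · nth_rewrite 2 [← Real.rpow_one t]
    rw [← Real.rpow_add ht]
    norm_num
  · rw [Real.rpow_neg ht.le, one_div]

theorem norm_integral_cexp_cos_le_of_pos {τ : ℝ} (hτ : 0 < τ) (c : ℝ) :
    ‖∫ x in (0 : ℝ)..Real.pi, Complex.exp (Complex.I * ((-(τ * (2 - 2 * Real.cos x)) + c * x : ℝ) : ℂ))‖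
      ≤ 22 * τ ^ (-(1 / 3) : ℝ) := by
  obtain ⟨hκ, h1, h2, h3⟩ := rpow_two_thirds_aux hτ
  have hr : 0 ≤ τ ^ (-(1 / 3) : ℝ) := by positivity
  have hcos : ∀ x ∈ Icc 0 Real.pi, |-(2 * τ * Real.cos x)| ≤ τ ^ (2 / 3 : ℝ) →
      |Real.pi / 2 - x| ≤ Real.pi / 4 * τ ^ (-(1 / 3) : ℝ) := by
    intro x hx h
    have hj : 2 / Real.pi * |Real.pi / 2 - x| ≤ |Real.sin (Real.pi / 2 - x)| :=
      Real.mul_abs_le_abs_sin (abs_le.2 ⟨by linarith [hx.2], by linarith [hx.1]⟩)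
    rw [Real.sin_pi_div_two_sub] at hj
    rw [abs_neg, abs_mul, abs_of_pos (by positivity : 0 < 2 * τ), h2] at h
    have h4 : |Real.cos x| ≤ τ ^ (-(1 / 3) : ℝ) / 2 := by
      have : τ * (2 * |Real.cos x|) ≤ τ * τ ^ (-(1 / 3) : ℝ) := by linarith
      linarith [le_of_mul_le_mul_left this hτ]
    have h5 : |Real.pi / 2 - x| = Real.pi / 2 * (2 / Real.pi * |Real.pi / 2 - x|) := by
      field_simp
    rw [h5]
    nlinarith [Real.pi_pos]
  have := norm_integral_cexp_le_of_monotoneOn_deriv2 (a := 0) (b := Real.pi)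
    (f := fun x => -(τ * (2 - 2 * Real.cos x)) + c * x) (f' := fun x => -(2 * τ * Real.sin x) + c)
    (f'' := fun x => -(2 * τ * Real.cos x)) (κ := τ ^ (2 / 3 : ℝ))
    (L := Real.pi / 2 * τ ^ (-(1 / 3) : ℝ)) Real.pi_pos.le hκ (by positivity)
    (fun x _ => by
      refine (((((Real.hasDerivAt_cos x).const_mul 2).const_sub 2).const_mul τ).neg.add
        ((hasDerivAt_id x).const_mul c)).congr_deriv ?_
      ring)
    (fun x _ => (((Real.hasDerivAt_sin x).const_mul (2 * τ)).neg.add_const c))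
    (by fun_prop)
    (fun x hx y hy hxy => by
      have := Real.antitoneOn_cos hx hy hxy
      simp only
      nlinarith)
    (fun x hx y hy hxy h4 h5 => by
      have h6 := abs_le.1 (hcos x hx h4)
      have h7 := abs_le.1 (hcos y hy h5)
      linarith [h6.2, h7.1])
  refine this.trans ?_
  rw [h1, ← mul_one_div 20, h3]
  nlinarith [Real.pi_lt_four]

theorem norm_integral_cexp_cos_le {τ : ℝ} (hτ : τ ≠ 0) (c : ℝ) :
    ‖∫ x in (0 : ℝ)..Real.pi, Complex.exp (Complex.I * ((-(τ * (2 - 2 * Real.cos x)) + c * x : ℝ) : ℂ))‖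
      ≤ 22 * |τ| ^ (-(1 / 3) : ℝ) := by
  rcases hτ.lt_or_gt with h | h
  · rw [← norm_integral_cexp_neg, abs_of_neg h]
    convert norm_integral_cexp_cos_le_of_pos (neg_pos.2 h) (-c) using 6
    push_cast
    ring
  · rw [abs_of_pos h]
    exact norm_integral_cexp_cos_le_of_pos h c

theorem exists_sineKernel_bound {q : ℝ} (hq : 0 < q) :
    ∃ C, ∀ n k t, ‖sineKernel q n k t‖ ≤ C * (|t| + 1) ^ (-(1 / 3) : ℝ) := by
  refine ⟨2 * (Real.pi + 22 * (q ^ 2) ^ (-(1 / 3) : ℝ)), fun n k => norm_le_mul_rpow_of_le ?_ ?_⟩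
  · intro t
    have := intervalIntegral.norm_integral_le_of_norm_le_const (a := 0) (b := Real.pi) (C := 1)
      (f := fun x => Complex.exp (-(t * (q ^ 2 * (2 - 2 * Real.cos x)) : ℝ) * Complex.I) *
        ((Real.sin (n * x) * Real.sin (k * x) : ℝ) : ℂ)) (fun x _ => by
      rw [← Complex.ofReal_neg, norm_mul, Complex.norm_exp_ofReal_mul_I, one_mul,
        Complex.norm_real, norm_mul]
      exact mul_le_one₀ (Real.abs_sin_le_one _) (norm_nonneg _) (Real.abs_sin_le_one _))
    rwa [sub_zero, abs_of_pos Real.pi_pos, one_mul] at this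
  · intro t ht
    have hτ : t * q ^ 2 ≠ 0 := mul_ne_zero (fun h => by norm_num [h] at ht) (by positivity)
    set E : ℝ → ℝ → ℂ := fun c x =>
      Complex.exp (Complex.I * ((-(t * q ^ 2 * (2 - 2 * Real.cos x)) + c * x : ℝ) : ℂ)) with hE
    have hEi : ∀ c, IntervalIntegrable (E c) volume 0 Real.pi := fun c =>
      (by fun_prop : Continuous (E c)).intervalIntegrable _ _
    have hEb : ∀ c, ‖∫ x in (0 : ℝ)..Real.pi, E c x‖ ≤ 22 * |t * q ^ 2| ^ (-(1 / 3) : ℝ) :=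
      fun c => norm_integral_cexp_cos_le hτ c
    have hsplit : sineKernel q n k t = ((∫ x in (0 : ℝ)..Real.pi, E (n - k) x)
        + (∫ x in (0 : ℝ)..Real.pi, E (-(n - k)) x) - (∫ x in (0 : ℝ)..Real.pi, E (n + k) x)
        - ∫ x in (0 : ℝ)..Real.pi, E (-(n + k)) x) / 4 := by
      rw [← intervalIntegral.integral_add (hEi _) (hEi _),
        ← intervalIntegral.integral_sub ((hEi _).add (hEi _)) (hEi _),
        ← intervalIntegral.integral_sub (((hEi _).add (hEi _)).sub (hEi _)) (hEi _),
        ← intervalIntegral.integral_div]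
      unfold sineKernel oscIntegral
      congr 1
      ext x
      have hexp : ∀ c, E c x = Complex.exp (-(t * (q ^ 2 * (2 - 2 * Real.cos x)) : ℝ) * Complex.I) *
          Complex.exp ((c * x : ℝ) * Complex.I) := fun c => by
        simp only [hE]
        rw [← Complex.exp_add]
        congr 1
        push_cast
        ring
      have hcs : ∀ c, Complex.exp ((c * x : ℝ) * Complex.I) + Complex.exp ((-c * x : ℝ) * Complex.I)
          = 2 * (Real.cos (c * x) : ℝ) := fun c => by
        rw [Complex.exp_mul_I, Complex.exp_mul_I, ← Complex.ofReal_cos, ← Complex.ofReal_cos,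
          ← Complex.ofReal_sin, ← Complex.ofReal_sin, neg_mul, Real.cos_neg, Real.sin_neg]
        push_cast
        ring
      have htrig : 2 * (Real.sin (n * x) * Real.sin (k * x))
          = Real.cos ((n - k) * x) - Real.cos ((n + k) * x) := by
        rw [sub_mul, add_mul, Real.cos_sub, Real.cos_add]
        ring
      have htrig' : 2 * ((Real.sin (n * x) * Real.sin (k * x) : ℝ) : ℂ)
          = (Real.cos ((n - k) * x) : ℝ) - (Real.cos ((n + k) * x) : ℝ) := by
        exact_mod_cast htrig
      simp only [hexp]
      linear_combination (Complex.exp (-(t * (q ^ 2 * (2 - 2 * Real.cos x)) : ℝ) * Complex.I)) *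
        (htrig' / 2 - hcs (n - k) / 4 + hcs (n + k) / 4)
    rw [abs_mul, abs_of_pos (by positivity : 0 < q ^ 2),
      Real.mul_rpow (abs_nonneg _) (by positivity)] at hEb
    rw [hsplit, norm_div]
    have h4 : ‖(4 : ℂ)‖ = 4 := by norm_num
    rw [h4, div_le_iff₀ (by norm_num)]
    refine (norm_sub_le _ _).trans ((add_le_add_left ((norm_sub_le _ _).trans
      (add_le_add_left (norm_add_le _ _) _)) _).trans ?_)
    linarith [hEb (n - k), hEb (-(n - k)), hEb (n + k), hEb (-(n + k))]

/-- Van der Corput estimate for a quadratic phase perturbed by a function whose second derivative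
grows at least exponentially. -/
theorem norm_integral_cexp_quadratic_add_le {g g' ψ : ℝ → ℝ} {a b p t : ℝ} (hab : a ≤ b)
    (hp : 0 ≤ p) (ht : 1 ≤ |t|) (h1 : ∀ x ∈ Icc a b, HasDerivAt g (g' x) x)
    (h2 : ∀ x ∈ Icc a b, HasDerivAt g' (ψ x) x) (hc : ContinuousOn ψ (Icc a b))
    (h0 : ∀ x ∈ Icc a b, 0 ≤ ψ x)
    (hgrow : ∀ x ∈ Icc a b, ∀ y ∈ Icc a b, x ≤ y → ψ x * (y - x) ≤ p * (ψ y - ψ x))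
    (hm : MonotoneOn ψ (Icc a b)) :
    ‖∫ x in a..b, Complex.exp (Complex.I * ((-(t * (4 * x ^ 2)) + g x : ℝ) : ℂ))‖
      ≤ (p + 20) * |t| ^ (-(1 / 3) : ℝ) := by
  have ht0 : 0 < |t| := by linarith
  obtain ⟨hκ, e1, e2, e3⟩ := rpow_two_thirds_aux ht0
  have hκt : |t| ^ (2 / 3 : ℝ) ≤ |t| := by
    conv_rhs => rw [← Real.rpow_one |t|]
    exact Real.rpow_le_rpow_of_exponent_le ht (by norm_num)
  have := norm_integral_cexp_le_of_monotoneOn_deriv2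
    (f := fun x => -(t * (4 * x ^ 2)) + g x) (f' := fun x => -(t * (8 * x)) + g' x)
    (f'' := fun x => -(8 * t) + ψ x) (κ := |t| ^ (2 / 3 : ℝ))
    (L := p * |t| ^ (-(1 / 3) : ℝ)) hab hκ (by positivity)
    (fun x hx => by
      refine (((((hasDerivAt_pow 2 x).const_mul 4)).const_mul t).neg.add (h1 x hx)).congr_deriv ?_
      push_cast
      ring)
    (fun x hx => by
      refine (((((hasDerivAt_id x).const_mul 8)).const_mul t).neg.add (h2 x hx)).congr_deriv ?_
      ring)
    (continuousOn_const.add hc)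
    (fun x hx y hy hxy => by
      have := hm hx hy hxy
      simp only
      linarith)
    (fun x hx y hy hxy hx1 hy1 => by
      rw [abs_le] at hx1 hy1
      rcases le_total 0 t with h | h
      · rw [abs_of_nonneg h] at *
        have h3 := hgrow x hx y hy hxy
        have h4 : 7 * t ≤ ψ x := by linarith [hx1.1]
        have h5 : ψ y - ψ x ≤ 2 * t ^ (2 / 3 : ℝ) := by linarith [hx1.1, hy1.2]
        have h6 : 7 * t * (y - x) ≤ p * (2 * t ^ (2 / 3 : ℝ)) := by
          calc _ ≤ ψ x * (y - x) := mul_le_mul_of_nonneg_right h4 (by linarith)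
            _ ≤ _ := h3
            _ ≤ _ := by gcongr
        rw [e2] at h6
        have h7 : 0 ≤ p * t ^ (-(1 / 3) : ℝ) := by positivity
        have h8 : t * (7 * (y - x)) ≤ t * (2 * (p * t ^ (-(1 / 3) : ℝ))) := by linarith
        linarith [le_of_mul_le_mul_left h8 ht0]
      · rw [abs_of_nonpos h] at *
        exfalso
        linarith [hx1.2, h0 x hx])
  refine this.trans (le_of_eq ?_)
  rw [e1, ← mul_one_div 20, e3]
  ring

theorem hasDerivAt_arcsin_div {p x : ℝ} (hp : 0 < p) (hx : |x| < p) :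
    HasDerivAt (fun x => Real.arcsin (x / p)) (1 / √(p ^ 2 - x ^ 2)) x := by
  rw [abs_lt] at hx
  have h1 : x / p ≠ -1 := by
    rw [Ne, div_eq_iff hp.ne']
    linarith [hx.1]
  have h2 : x / p ≠ 1 := by
    rw [Ne, div_eq_iff hp.ne']
    linarith [hx.2]
  refine ((Real.hasDerivAt_arcsin h1 h2).comp x ((hasDerivAt_id x).div_const p)).congr_deriv ?_
  have e : p ^ 2 - x ^ 2 = p ^ 2 * (1 - (x / p) ^ 2) := by field_simp
  rw [e, Real.sqrt_mul (by positivity), Real.sqrt_sq hp.le]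
  simp only [one_div, mul_inv]
  ring

theorem hasDerivAt_sqrt_sq_sub {p x : ℝ} (hx : |x| < p) :
    HasDerivAt (fun x => √(p ^ 2 - x ^ 2)) (-(x / √(p ^ 2 - x ^ 2))) x := by
  rw [abs_lt] at hx
  have h : 0 < p ^ 2 - x ^ 2 := by nlinarith [hx.1, hx.2]
  have h' := Real.sqrt_pos.2 h
  refine (((hasDerivAt_pow 2 x).const_sub (p ^ 2)).sqrt h.ne').congr_deriv ?_
  norm_num
  field_simp

theorem hasDerivAt_inv_sqrt_sq_sub {p x : ℝ} (hx : |x| < p) :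
    HasDerivAt (fun x => 1 / √(p ^ 2 - x ^ 2)) (x / √(p ^ 2 - x ^ 2) ^ 3) x := by
  have h := hasDerivAt_sqrt_sq_sub hx
  rw [abs_lt] at hx
  have h' := Real.sqrt_pos.2 (by nlinarith [hx.1, hx.2] : 0 < p ^ 2 - x ^ 2)
  simp only [one_div]
  refine (h.inv h'.ne').congr_deriv ?_
  field_simp

theorem hasDerivAt_sqrt_sub_sq {q x : ℝ} (hq : 0 < q) (hx : q < x) :
    HasDerivAt (fun x => √(x ^ 2 - q ^ 2)) (x / √(x ^ 2 - q ^ 2)) x := by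
  have h : 0 < x ^ 2 - q ^ 2 := by nlinarith
  have h' := Real.sqrt_pos.2 h
  refine (((hasDerivAt_pow 2 x).sub_const (q ^ 2)).sqrt h.ne').congr_deriv ?_
  norm_num
  field_simp

theorem div_sqrt_cube_growth {p x y : ℝ} (hx : 0 ≤ x) (hxy : x ≤ y) (hy : y < p) :
    x / √(p ^ 2 - x ^ 2) ^ 3 * (y - x)
      ≤ p * (y / √(p ^ 2 - y ^ 2) ^ 3 - x / √(p ^ 2 - x ^ 2) ^ 3) := by
  have hy0 : 0 < √(p ^ 2 - y ^ 2) := Real.sqrt_pos.2 (by nlinarith)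
  have hle : √(p ^ 2 - y ^ 2) ≤ √(p ^ 2 - x ^ 2) := Real.sqrt_le_sqrt (by nlinarith)
  have hx0 := hy0.trans_le hle
  set c := (√(p ^ 2 - x ^ 2) ^ 3)⁻¹ with hc
  have hc0 : 0 < c := by positivity
  have hcd : c ≤ (√(p ^ 2 - y ^ 2) ^ 3)⁻¹ := by
    rw [hc]
    gcongr
  rw [div_eq_mul_inv, div_eq_mul_inv, ← hc]
  have h1 : y * c ≤ y * (√(p ^ 2 - y ^ 2) ^ 3)⁻¹ := mul_le_mul_of_nonneg_left hcd (hx.trans hxy)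
  have h2 : x * (c * (y - x)) ≤ p * (c * (y - x)) :=
    mul_le_mul_of_nonneg_right (by linarith) (mul_nonneg hc0.le (by linarith))
  have hp : 0 ≤ p := by linarith
  nlinarith [mul_le_mul_of_nonneg_left h1 hp]

theorem continuousOn_div_sqrt_cube {p a b : ℝ} (ha : 0 ≤ a) (hb : b < p) :
    ContinuousOn (fun x => x / √(p ^ 2 - x ^ 2) ^ 3) (Icc a b) := by
  refine ContinuousOn.div (by fun_prop) (by fun_prop) fun x hx => ?_
  have : 0 < √(p ^ 2 - x ^ 2) := Real.sqrt_pos.2 (by nlinarith [hx.1, hx.2])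
  positivity

/-- The phases of the two transmitted waves inside both bands. -/
theorem norm_integral_cexp_arcsin_le {p q a b t : ℝ} (hq : 0 < q) (hqp : q ≤ p) (ha : 0 ≤ a)
    (hab : a ≤ b) (hb : b < q) (ht : 1 ≤ |t|) (m n : ℕ) :
    ‖∫ x in a..b, Complex.exp (Complex.I * ((-(t * (4 * x ^ 2)) +
      (2 * m * Real.arcsin (x / p) + 2 * n * Real.arcsin (x / q)) : ℝ) : ℂ))‖
      ≤ (p + 20) * |t| ^ (-(1 / 3) : ℝ) := by
  have hp : 0 < p := hq.trans_le hqp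
  have hxq : ∀ x ∈ Icc a b, |x| < q := fun x hx =>
    abs_lt.2 ⟨by linarith [hx.1], by linarith [hx.2]⟩
  have hxp : ∀ x ∈ Icc a b, |x| < p := fun x hx => (hxq x hx).trans_le hqp
  have hnn : ∀ r x : ℝ, 0 ≤ x → 0 ≤ x / √(r ^ 2 - x ^ 2) ^ 3 := fun r x hx => by positivity
  have hgr : ∀ x ∈ Icc a b, ∀ y ∈ Icc a b, x ≤ y →
      (2 * m * (x / √(p ^ 2 - x ^ 2) ^ 3) + 2 * n * (x / √(q ^ 2 - x ^ 2) ^ 3)) * (y - x)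
      ≤ p * (2 * m * (y / √(p ^ 2 - y ^ 2) ^ 3) + 2 * n * (y / √(q ^ 2 - y ^ 2) ^ 3)
        - (2 * m * (x / √(p ^ 2 - x ^ 2) ^ 3) + 2 * n * (x / √(q ^ 2 - x ^ 2) ^ 3))) := by
    intro x hx y hy hxy
    have hx0 := ha.trans hx.1
    have h1 := div_sqrt_cube_growth (p := p) hx0 hxy (by linarith [hy.2])
    have h2 := div_sqrt_cube_growth (p := q) hx0 hxy (by linarith [hy.2])
    have h3 : 0 ≤ y / √(q ^ 2 - y ^ 2) ^ 3 - x / √(q ^ 2 - x ^ 2) ^ 3 := by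
      have := mul_nonneg (hnn q x hx0) (sub_nonneg.2 hxy)
      exact nonneg_of_mul_nonneg_right (this.trans h2) hq
    have h4 := h2.trans (mul_le_mul_of_nonneg_right hqp h3)
    have hm0 : (0 : ℝ) ≤ 2 * m := by positivity
    have hn0 : (0 : ℝ) ≤ 2 * n := by positivity
    linarith [mul_le_mul_of_nonneg_left h1 hm0, mul_le_mul_of_nonneg_left h4 hn0]
  have h0 : ∀ x ∈ Icc a b, 0 ≤ 2 * m * (x / √(p ^ 2 - x ^ 2) ^ 3)
      + 2 * n * (x / √(q ^ 2 - x ^ 2) ^ 3) := fun x hx => by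
    have h1 := hnn p x (ha.trans hx.1)
    have h2 := hnn q x (ha.trans hx.1)
    positivity
  refine norm_integral_cexp_quadratic_add_le hab hp.le ht
    (g' := fun x => 2 * m * (1 / √(p ^ 2 - x ^ 2)) + 2 * n * (1 / √(q ^ 2 - x ^ 2)))
    (ψ := fun x => 2 * m * (x / √(p ^ 2 - x ^ 2) ^ 3) + 2 * n * (x / √(q ^ 2 - x ^ 2) ^ 3))
    (fun x hx => ((hasDerivAt_arcsin_div hp (hxp x hx)).const_mul _).add
      ((hasDerivAt_arcsin_div hq (hxq x hx)).const_mul _))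
    (fun x hx => ((hasDerivAt_inv_sqrt_sq_sub (hxp x hx)).const_mul _).add
      ((hasDerivAt_inv_sqrt_sq_sub (hxq x hx)).const_mul _)) ?_ h0 hgr ?_
  · exact (continuousOn_const.mul (continuousOn_div_sqrt_cube ha (hb.trans_le hqp))).add
      (continuousOn_const.mul (continuousOn_div_sqrt_cube ha hb))
  · intro x hx y hy hxy
    have := (mul_nonneg (h0 x hx) (sub_nonneg.2 hxy)).trans (hgr x hx y hy hxy)
    exact sub_nonneg.1 (nonneg_of_mul_nonneg_right this hp)

/-- An amplitude `B / D` with `B` decreasing from at most `1` and `D` bounded below. -/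
theorem norm_integral_div_mul_le {e D D' : ℝ → ℂ} {B B' δ d : ℝ → ℝ} {a b p V M : ℝ}
    (hab : a ≤ b) (hp : 0 < p) (hM : 0 ≤ M) (he : ContinuousOn e (Icc a b))
    (hprim : ∀ x ∈ Icc a b, ‖∫ y in a..x, e y‖ ≤ M)
    (hD : ∀ x ∈ Icc a b, HasDerivAt D (D' x) x) (hDc : ContinuousOn D' (Icc a b))
    (hDp : ∀ x ∈ Icc a b, p ≤ ‖D x‖) (hd : ∀ x ∈ Icc a b, ‖D' x‖ ≤ d x)
    (hδ : ∀ x ∈ Icc a b, HasDerivAt δ (d x) x) (hdc : ContinuousOn d (Icc a b))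
    (hV : δ b - δ a ≤ V) (hB : ∀ x ∈ Icc a b, HasDerivAt B (B' x) x)
    (hBc : ContinuousOn B' (Icc a b)) (hB' : ∀ x ∈ Icc a b, B' x ≤ 0)
    (hB0 : ∀ x ∈ Icc a b, 0 ≤ B x) (hB1 : ∀ x ∈ Icc a b, B x ≤ 1) :
    ‖∫ x in a..b, B x / D x * e x‖ ≤ M * (2 / p + V / p ^ 2) := by
  have hD0 : ∀ x ∈ Icc a b, D x ≠ 0 := fun x hx h => by
    have := hDp x hx
    rw [h, norm_zero] at this
    linarith
  have hDcont : ContinuousOn D (Icc a b) := fun x hx => (hD x hx).continuousAt.continuousWithinAt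
  have hBcont : ContinuousOn B (Icc a b) := fun x hx => (hB x hx).continuousAt.continuousWithinAt
  have ha : a ∈ Icc a b := ⟨le_rfl, hab⟩
  have hb : b ∈ Icc a b := ⟨hab, le_rfl⟩
  have hI : uIcc a b = Icc a b := uIcc_of_le hab
  have hA'c : ContinuousOn (fun x => (B' x * D x - B x * D' x) / D x ^ 2) (Icc a b) :=
    (((Complex.continuous_ofReal.comp_continuousOn hBc).mul hDcont).sub
      ((Complex.continuous_ofReal.comp_continuousOn hBcont).mul hDc)).div (hDcont.pow 2)
      fun x hx => pow_ne_zero 2 (hD0 x hx)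
  have hmain := norm_integral_mul_le_of_primitive_le (A := fun x => B x / D x) hab he
    (fun x hx => ((hB x hx).ofReal_comp).div (hD x hx) (hD0 x hx)) hA'c hprim
  refine hmain.trans (mul_le_mul_of_nonneg_left ?_ hM)
  have hdc' : ContinuousOn (fun x => -B' x / p + d x / p ^ 2) (Icc a b) :=
    (hBc.neg.div_const p).add (hdc.div_const _)
  have hbound : ∀ x ∈ Icc a b,
      ‖(B' x * D x - B x * D' x) / D x ^ 2‖ ≤ -B' x / p + d x / p ^ 2 := by
    intro x hx
    have hDx := hDp x hx
    have hDpos : 0 < ‖D x‖ := hp.trans_le hDx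
    have e1 : (B' x * D x - B x * D' x) / D x ^ 2
        = B' x / D x - B x * D' x / D x ^ 2 := by
      have := hD0 x hx
      field_simp
    rw [e1]
    refine (norm_sub_le _ _).trans (add_le_add ?_ ?_)
    · rw [norm_div, Complex.norm_real, Real.norm_of_nonpos (hB' x hx)]
      have := hB' x hx
      exact div_le_div_of_nonneg_left (by linarith) hp hDx
    · rw [norm_div, norm_mul, Complex.norm_real, Real.norm_of_nonneg (hB0 x hx), norm_pow]
      have h1 : B x * ‖D' x‖ ≤ d x :=
        (mul_le_of_le_one_left (norm_nonneg _) (hB1 x hx)).trans (hd x hx)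
      exact div_le_div₀ ((norm_nonneg _).trans (hd x hx)) h1 (by positivity) (by gcongr)
  have hint : ∫ x in a..b, ‖(B' x * D x - B x * D' x) / D x ^ 2‖ ≤ 1 / p + V / p ^ 2 := by
    have hi1 : IntervalIntegrable (fun x => ‖(B' x * D x - B x * D' x) / D x ^ 2‖) volume a b := by
      refine ContinuousOn.intervalIntegrable ?_
      rw [hI]
      exact hA'c.norm
    have hi2 : IntervalIntegrable (fun x => -B' x / p + d x / p ^ 2) volume a b := by
      refine ContinuousOn.intervalIntegrable ?_
      rw [hI]
      exact hdc'
    refine (intervalIntegral.integral_mono_on hab hi1 hi2 hbound).trans ?_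
    have := intervalIntegral.integral_eq_sub_of_hasDerivAt
      (f := fun x => -B x / p + δ x / p ^ 2) (f' := fun x => -B' x / p + d x / p ^ 2)
      (a := a) (b := b) (fun x hx => by
        rw [hI] at hx
        exact ((hB x hx).neg.div_const p).add ((hδ x hx).div_const _)) hi2
    rw [this]
    have h1 : (B a - B b) / p ≤ 1 / p := by
      gcongr
      linarith [hB1 a ha, hB0 b hb]
    have h2 : (δ b - δ a) / p ^ 2 ≤ V / p ^ 2 := by gcongr
    calc _ = (B a - B b) / p + (δ b - δ a) / p ^ 2 := by ring
      _ ≤ _ := add_le_add h1 h2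
  have hend : ‖(B b : ℂ) / D b‖ ≤ 1 / p := by
    rw [norm_div, Complex.norm_real, Real.norm_of_nonneg (hB0 b hb)]
    exact div_le_div₀ zero_le_one (hB1 b hb) hp (hDp b hb)
  calc _ ≤ 1 / p + (1 / p + V / p ^ 2) := add_le_add hend hint
    _ = _ := by ring

theorem norm_integral_le_of_forall_Ioo {h : ℝ → ℂ} {a b C : ℝ} (hh : Continuous h) (hab : a < b)
    (hC : ∀ x y, a < x → x ≤ y → y < b → ‖∫ z in x..y, h z‖ ≤ C) : ‖∫ z in a..b, h z‖ ≤ C := by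
  have hi : ∀ x y, IntervalIntegrable h volume x y := fun x y => hh.intervalIntegrable x y
  have hF : Continuous fun y => ∫ z in a..y, h z := intervalIntegral.continuous_primitive hi a
  have hlim : Filter.Tendsto (fun ε : ℝ => ‖(∫ z in a..(b - ε), h z) - ∫ z in a..(a + ε), h z‖)
      (nhdsWithin 0 (Ioi 0)) (nhds ‖(∫ z in a..(b - 0), h z) - ∫ z in a..(a + 0), h z‖) := by
    refine Filter.Tendsto.mono_left ?_ nhdsWithin_le_nhds
    have hcont : Continuous fun ε : ℝ => ‖(∫ z in a..(b - ε), h z) - ∫ z in a..(a + ε), h z‖ :=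
      ((hF.comp (by fun_prop : Continuous fun ε : ℝ => b - ε)).sub
        (hF.comp (by fun_prop : Continuous fun ε : ℝ => a + ε))).norm
    exact hcont.tendsto 0
  rw [sub_zero, add_zero, intervalIntegral.integral_same, sub_zero] at hlim
  refine le_of_tendsto hlim ?_
  filter_upwards [Ioo_mem_nhdsGT (by linarith : 0 < (b - a) / 2)] with ε hε
  rw [intervalIntegral.integral_interval_sub_left (hi _ _) (hi _ _)]
  exact hC _ _ (by linarith [hε.1]) (by linarith [hε.2]) (by linarith [hε.1])

theorem le_norm_halfWave_add {p q x : ℝ} (hq : 0 < q) (hqp : q ≤ p) (hx : 0 ≤ x) (hxp : x ≤ p) :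
    p ≤ ‖halfWave p x + halfWave q x‖ := by
  have hp : 0 < p := hq.trans_le hqp
  have h1 := halfWave_ofReal_of_abs_le (p := p) (abs_le.2 ⟨by linarith, hxp⟩)
  have key : √(p ^ 2 - x ^ 2) ≤ (halfWave p x + halfWave q x).re ∧
      x ≤ (halfWave p x + halfWave q x).im := by
    rw [h1]
    rcases le_total x q with h | h
    · rw [halfWave_ofReal_of_abs_le (p := q) (abs_le.2 ⟨by linarith, h⟩)]
      simp [hx, Real.sqrt_nonneg]
    · rw [halfWave_ofReal_of_le hq.le h]
      have : √(x ^ 2 - q ^ 2) ≤ x := Real.sqrt_le_iff.2 ⟨hx, by nlinarith⟩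
      simp [this]
  have hs : √(p ^ 2 - x ^ 2) ^ 2 = p ^ 2 - x ^ 2 := Real.sq_sqrt (by nlinarith)
  have hn := Complex.sq_norm (halfWave p x + halfWave q x)
  rw [Complex.normSq_apply] at hn
  refine le_of_sq_le_sq ?_ (norm_nonneg _)
  have h2 := mul_self_le_mul_self (Real.sqrt_nonneg _) key.1
  have h3 := mul_self_le_mul_self hx key.2
  nlinarith

theorem halfWave_div_eq_cexp {p x : ℝ} (hp : 0 < p) (hx : |x| ≤ p) :
    halfWave p x / p = Complex.exp (Complex.I * Real.arcsin (x / p)) := by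
  have hp' : (p : ℂ) ≠ 0 := by exact_mod_cast hp.ne'
  have h := abs_le.1 hx
  have e : p ^ 2 - x ^ 2 = p ^ 2 * (1 - (x / p) ^ 2) := by field_simp
  rw [halfWave_ofReal_of_abs_le hx, mul_comm Complex.I (Real.arcsin (x / p) : ℂ), Complex.exp_mul_I, ← Complex.ofReal_cos,
    ← Complex.ofReal_sin, Real.cos_arcsin, Real.sin_arcsin
      (by rw [le_div_iff₀ hp]; linarith [h.1]) (by rw [div_le_iff₀ hp]; linarith [h.2]),
    e, Real.sqrt_mul (by positivity), Real.sqrt_sq hp.le, div_eq_iff hp']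
  push_cast
  field_simp

theorem hasDerivAt_halfWave_of_lt {p x : ℝ} (hx : |x| < p) :
    HasDerivAt (fun x : ℝ => halfWave p x) (-(x / √(p ^ 2 - x ^ 2) : ℝ) + Complex.I) x := by
  have h1 : HasDerivAt (fun x : ℝ => ((√(p ^ 2 - x ^ 2) : ℝ) : ℂ) + Complex.I * x)
      (-(x / √(p ^ 2 - x ^ 2) : ℝ) + Complex.I) x := by
    refine ((hasDerivAt_sqrt_sq_sub hx).ofReal_comp.add
      ((hasDerivAt_id x).ofReal_comp.const_mul Complex.I)).congr_deriv ?_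
    push_cast
    ring
  refine h1.congr_of_eventuallyEq ?_
  filter_upwards [(isOpen_lt continuous_abs continuous_const).mem_nhds hx] with y hy
  exact halfWave_ofReal_of_abs_le (le_of_lt hy)

theorem hasDerivAt_halfWave_of_gt {q x : ℝ} (hq : 0 < q) (hx : q < x) :
    HasDerivAt (fun x : ℝ => halfWave q x) (Complex.I * (1 - x / √(x ^ 2 - q ^ 2) : ℝ)) x := by
  have h1 : HasDerivAt (fun x : ℝ => Complex.I * ((x - √(x ^ 2 - q ^ 2) : ℝ) : ℂ))
      (Complex.I * (1 - x / √(x ^ 2 - q ^ 2) : ℝ)) x :=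
    ((hasDerivAt_id x).sub (hasDerivAt_sqrt_sub_sq hq hx)).ofReal_comp.const_mul Complex.I
  refine h1.congr_of_eventuallyEq ?_
  filter_upwards [lt_mem_nhds hx] with y hy
  exact halfWave_ofReal_of_le hq.le (le_of_lt hy)

theorem norm_osc_inner_le {p q a b t : ℝ} (hq : 0 < q) (hqp : q ≤ p) (ha : 0 < a) (hab : a ≤ b)
    (hb : b < q) (ht : 1 ≤ |t|) (m n : ℕ) :
    ‖∫ x in a..b, Complex.exp (-(t * (4 * x ^ 2) : ℝ) * Complex.I) * waveDensity p q m n x‖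
      ≤ (p + 20) * |t| ^ (-(1 / 3) : ℝ) * (2 / p + 4 * p / p ^ 2) := by
  have hp : 0 < p := hq.trans_le hqp
  have hxq : ∀ x ∈ Icc a b, |x| < q := fun x hx =>
    abs_lt.2 ⟨by linarith [hx.1], by linarith [hx.2]⟩
  have hxp : ∀ x ∈ Icc a b, |x| < p := fun x hx => (hxq x hx).trans_le hqp
  have hpos : ∀ r, b < r → ∀ x ∈ Icc a b, √(r ^ 2 - x ^ 2) ≠ 0 := fun r hr x hx =>
    (Real.sqrt_pos.2 (by nlinarith [hx.1, hx.2])).ne'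
  have hcq : ContinuousOn (fun x => x / √(q ^ 2 - x ^ 2)) (Icc a b) :=
    ContinuousOn.div (by fun_prop) (by fun_prop) (hpos q hb)
  have hcp : ContinuousOn (fun x => x / √(p ^ 2 - x ^ 2)) (Icc a b) :=
    ContinuousOn.div (by fun_prop) (by fun_prop) (hpos p (by linarith))
  have hcq' := Complex.continuous_ofReal.comp_continuousOn hcq
  have hcp' := Complex.continuous_ofReal.comp_continuousOn hcp
  have hmain := norm_integral_div_mul_le (a := a) (b := b) (p := p) (V := 4 * p)
    (M := (p + 20) * |t| ^ (-(1 / 3) : ℝ))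
    (e := fun x => Complex.exp (Complex.I * ((-(t * (4 * x ^ 2)) +
      (2 * m * Real.arcsin (x / p) + 2 * n * Real.arcsin (x / q)) : ℝ) : ℂ)))
    (D := fun x => halfWave p x + halfWave q x)
    (D' := fun x => (-(x / √(p ^ 2 - x ^ 2) : ℝ) + Complex.I)
      + (-(x / √(q ^ 2 - x ^ 2) : ℝ) + Complex.I))
    (B := fun _ => 1) (B' := fun _ => 0)
    (δ := fun x => -√(p ^ 2 - x ^ 2) - √(q ^ 2 - x ^ 2) + 2 * x)
    (d := fun x => x / √(p ^ 2 - x ^ 2) + x / √(q ^ 2 - x ^ 2) + 2)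
    hab hp (by positivity) ?_ ?_ ?_ ?_ ?_ ?_ ?_ ?_ ?_ ?_ ?_ ?_ ?_ ?_
  · refine le_of_eq_of_le ?_ hmain
    congr 1
    refine intervalIntegral.integral_congr fun x hx => ?_
    rw [uIcc_of_le hab] at hx
    simp only [waveDensity, halfWave_div_eq_cexp hp (hxp x hx).le,
      halfWave_div_eq_cexp hq (hxq x hx).le]
    rw [← Complex.exp_nat_mul, ← Complex.exp_nat_mul, ← Complex.exp_add, Complex.ofReal_one,
      mul_div_assoc', ← Complex.exp_add, div_mul_eq_mul_div, one_mul]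
    congr 2
    push_cast
    ring
  · exact (Continuous.continuousOn (by fun_prop))
  · intro x hx
    exact norm_integral_cexp_arcsin_le hq hqp ha.le hx.1 (hx.2.trans_lt hb) ht m n
  · exact fun x hx => (hasDerivAt_halfWave_of_lt (hxp x hx)).add
      (hasDerivAt_halfWave_of_lt (hxq x hx))
  · exact (hcp'.neg.add continuousOn_const).add (hcq'.neg.add continuousOn_const)
  · exact fun x hx => le_norm_halfWave_add hq hqp (ha.le.trans hx.1) (by linarith [hx.2])
  · intro x hx
    have hx0 : 0 ≤ x := ha.le.trans hx.1
    refine (norm_add_le _ _).trans ((add_le_add (norm_add_le _ _) (norm_add_le _ _)).trans ?_)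
    rw [norm_neg, norm_neg, Complex.norm_real, Complex.norm_real, Complex.norm_I,
      Real.norm_of_nonneg (by positivity), Real.norm_of_nonneg (by positivity)]
    linarith
  · intro x hx
    refine (((hasDerivAt_sqrt_sq_sub (hxp x hx)).neg.sub
      (hasDerivAt_sqrt_sq_sub (hxq x hx))).add ((hasDerivAt_id x).const_mul 2)).congr_deriv ?_
    ring
  · exact (hcp.add hcq).add continuousOn_const
  · have h1 : √(p ^ 2 - a ^ 2) ≤ p := Real.sqrt_le_iff.2 ⟨hp.le, by nlinarith⟩
    have h2 : √(q ^ 2 - a ^ 2) ≤ q := Real.sqrt_le_iff.2 ⟨hq.le, by nlinarith⟩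
    linarith [Real.sqrt_nonneg (p ^ 2 - b ^ 2), Real.sqrt_nonneg (q ^ 2 - b ^ 2)]
  · exact fun x _ => hasDerivAt_const x 1
  · exact continuousOn_const
  · exact fun _ _ => le_rfl
  · exact fun _ _ => zero_le_one
  · exact fun _ _ => le_rfl

theorem norm_osc_outer_le {p q a b t : ℝ} (hq : 0 < q) (ha : q < a) (hab : a ≤ b)
    (hb : b < p) (ht : 1 ≤ |t|) (m n : ℕ) :
    ‖∫ x in a..b, Complex.exp (-(t * (4 * x ^ 2) : ℝ) * Complex.I) * waveDensity p q m n x‖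
      ≤ (p + 20) * |t| ^ (-(1 / 3) : ℝ) * (2 / p + 4 * p / p ^ 2) := by
  have hp : 0 < p := by linarith
  have hqp : q ≤ p := by linarith
  have ha0 : 0 < a := hq.trans ha
  have hxp : ∀ x ∈ Icc a b, |x| < p := fun x hx =>
    abs_lt.2 ⟨by linarith [hx.1], by linarith [hx.2]⟩
  have hposp : ∀ x ∈ Icc a b, √(p ^ 2 - x ^ 2) ≠ 0 := fun x hx =>
    (Real.sqrt_pos.2 (by nlinarith [hx.1, hx.2])).ne'
  have hposq : ∀ x ∈ Icc a b, 0 < √(x ^ 2 - q ^ 2) := fun x hx =>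
    Real.sqrt_pos.2 (by nlinarith [hx.1, hx.2])
  have hltq : ∀ x ∈ Icc a b, √(x ^ 2 - q ^ 2) ≤ x := fun x hx =>
    Real.sqrt_le_iff.2 ⟨by linarith [hx.1], by nlinarith⟩
  have hone : ∀ x ∈ Icc a b, 1 ≤ x / √(x ^ 2 - q ^ 2) := fun x hx => by
    rw [one_le_div (hposq x hx)]
    exact hltq x hx
  have hr0 : ∀ x ∈ Icc a b, 0 ≤ (x - √(x ^ 2 - q ^ 2)) / q := fun x hx =>
    div_nonneg (by linarith [hltq x hx]) hq.le
  have hr1 : ∀ x ∈ Icc a b, (x - √(x ^ 2 - q ^ 2)) / q ≤ 1 := fun x hx => by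
    rw [div_le_one hq, sub_le_comm]
    refine Real.le_sqrt_of_sq_le ?_
    nlinarith [hx.1]
  have hcq : ContinuousOn (fun x => x / √(x ^ 2 - q ^ 2)) (Icc a b) :=
    ContinuousOn.div (by fun_prop) (by fun_prop) fun x hx => (hposq x hx).ne'
  have hcp : ContinuousOn (fun x => x / √(p ^ 2 - x ^ 2)) (Icc a b) :=
    ContinuousOn.div (by fun_prop) (by fun_prop) hposp
  have hcq' := Complex.continuous_ofReal.comp_continuousOn (continuousOn_const.sub hcq : ContinuousOn
    (fun x => 1 - x / √(x ^ 2 - q ^ 2)) (Icc a b))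
  have hcp' := Complex.continuous_ofReal.comp_continuousOn hcp
  have hmain := norm_integral_div_mul_le (a := a) (b := b) (p := p) (V := 4 * p)
    (M := (p + 20) * |t| ^ (-(1 / 3) : ℝ))
    (e := fun x => Complex.exp (Complex.I * ((-(t * (4 * x ^ 2)) +
      (2 * m * Real.arcsin (x / p)) : ℝ) : ℂ)))
    (D := fun x => halfWave p x + halfWave q x)
    (D' := fun x => (-(x / √(p ^ 2 - x ^ 2) : ℝ) + Complex.I)
      + Complex.I * (1 - x / √(x ^ 2 - q ^ 2) : ℝ))
    (B := fun x => ((x - √(x ^ 2 - q ^ 2)) / q) ^ (2 * n))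
    (B' := fun x => ((2 * n : ℕ) : ℝ) * ((x - √(x ^ 2 - q ^ 2)) / q) ^ (2 * n - 1)
      * ((1 - x / √(x ^ 2 - q ^ 2)) / q))
    (δ := fun x => -√(p ^ 2 - x ^ 2) + √(x ^ 2 - q ^ 2))
    (d := fun x => x / √(p ^ 2 - x ^ 2) + x / √(x ^ 2 - q ^ 2))
    hab hp (by positivity) ?_ ?_ ?_ ?_ ?_ ?_ ?_ ?_ ?_ ?_ ?_ ?_ ?_ ?_
  · refine le_of_eq_of_le ?_ hmain
    have e : ∀ x ∈ uIcc a b, Complex.exp (-(t * (4 * x ^ 2) : ℝ) * Complex.I)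
        * waveDensity p q m n x = (-1) ^ n * ((((x - √(x ^ 2 - q ^ 2)) / q) ^ (2 * n) : ℝ)
          / (halfWave p x + halfWave q x) * Complex.exp (Complex.I * ((-(t * (4 * x ^ 2)) +
            (2 * m * Real.arcsin (x / p)) : ℝ) : ℂ))) := fun x hx => by
      rw [uIcc_of_le hab] at hx
      have h1 : Complex.exp (Complex.I * ((-(t * (4 * x ^ 2)) + (2 * m * Real.arcsin (x / p)) : ℝ) : ℂ))
          = Complex.exp (-(t * (4 * x ^ 2) : ℝ) * Complex.I) * (halfWave p x / p) ^ (2 * m) := by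
        rw [halfWave_div_eq_cexp hp (hxp x hx).le, ← Complex.exp_nat_mul, ← Complex.exp_add]
        congr 1
        push_cast
        ring
      have h2 : (halfWave q x / q) ^ (2 * n)
          = (-1) ^ n * (((x - √(x ^ 2 - q ^ 2)) / q) ^ (2 * n) : ℝ) := by
        rw [halfWave_ofReal_of_le hq.le (by linarith [hx.1]), mul_div_assoc, mul_pow, pow_mul,
          Complex.I_sq]
        push_cast
        ring
      rw [h1, waveDensity, h2]
      ring
    rw [intervalIntegral.integral_congr e, intervalIntegral.integral_const_mul, norm_mul, norm_pow,
      norm_neg, norm_one, one_pow, one_mul]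
  · exact (Continuous.continuousOn (by fun_prop))
  · intro x hx
    refine norm_integral_cexp_quadratic_add_le hx.1 hp.le ht
      (g' := fun x => 2 * m * (1 / √(p ^ 2 - x ^ 2)))
      (ψ := fun x => 2 * m * (x / √(p ^ 2 - x ^ 2) ^ 3))
      (fun y hy => (hasDerivAt_arcsin_div hp (hxp y ⟨hy.1, hy.2.trans hx.2⟩)).const_mul _)
      (fun y hy => (hasDerivAt_inv_sqrt_sq_sub (hxp y ⟨hy.1, hy.2.trans hx.2⟩)).const_mul _)
      (continuousOn_const.mul (continuousOn_div_sqrt_cube ha0.le (hx.2.trans_lt hb))) ?_ ?_ ?_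
    · intro y hy
      have : 0 ≤ y := ha0.le.trans hy.1
      positivity
    · intro y hy z hz hyz
      have h1 := div_sqrt_cube_growth (p := p) (ha0.le.trans hy.1) hyz (by linarith [hz.2, hx.2])
      have hm0 : (0 : ℝ) ≤ 2 * m := by positivity
      linarith [mul_le_mul_of_nonneg_left h1 hm0]
    · intro y hy z hz hyz
      have hy0 : 0 ≤ y := ha0.le.trans hy.1
      have h1 := div_sqrt_cube_growth (p := p) hy0 hyz (by linarith [hz.2, hx.2])
      have h2 : 0 ≤ y / √(p ^ 2 - y ^ 2) ^ 3 * (z - y) :=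
        mul_nonneg (by positivity) (by linarith)
      have h3 := nonneg_of_mul_nonneg_right (h2.trans h1) hp
      have hm0 : (0 : ℝ) ≤ 2 * m := by positivity
      exact mul_le_mul_of_nonneg_left (sub_nonneg.1 h3) hm0
  · exact fun x hx => (hasDerivAt_halfWave_of_lt (hxp x hx)).add
      (hasDerivAt_halfWave_of_gt hq (by linarith [hx.1]))
  · exact (hcp'.neg.add continuousOn_const).add (continuousOn_const.mul hcq')
  · exact fun x hx => le_norm_halfWave_add hq hqp (ha0.le.trans hx.1) (by linarith [hx.2])
  · intro x hx
    have hx0 : 0 ≤ x := ha0.le.trans hx.1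
    refine (norm_add_le _ _).trans ((add_le_add_left (norm_add_le _ _) _).trans ?_)
    rw [norm_neg, norm_mul, Complex.norm_real, Complex.norm_real, Complex.norm_I,
      Real.norm_of_nonneg (by positivity), Real.norm_of_nonpos (by linarith [hone x hx])]
    linarith
  · intro x hx
    refine ((hasDerivAt_sqrt_sq_sub (hxp x hx)).neg.add
      (hasDerivAt_sqrt_sub_sq hq (by linarith [hx.1]))).congr_deriv ?_
    ring
  · exact hcp.add hcq
  · have h1 : √(p ^ 2 - a ^ 2) ≤ p := Real.sqrt_le_iff.2 ⟨hp.le, by nlinarith⟩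
    have h2 := hltq b ⟨hab, le_rfl⟩
    linarith [Real.sqrt_nonneg (p ^ 2 - b ^ 2), Real.sqrt_nonneg (a ^ 2 - q ^ 2)]
  · intro x hx
    exact (((hasDerivAt_id x).sub (hasDerivAt_sqrt_sub_sq hq (by linarith [hx.1]))).div_const q).pow
      (2 * n)
  · exact (Continuous.continuousOn (by fun_prop)).mul ((continuousOn_const.sub hcq).div_const q)
  · intro x hx
    refine mul_nonpos_of_nonneg_of_nonpos (mul_nonneg (by positivity) (pow_nonneg (hr0 x hx) _)) ?_
    exact div_nonpos_of_nonpos_of_nonneg (by linarith [hone x hx]) hq.le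
  · exact fun x hx => pow_nonneg (hr0 x hx) _
  · exact fun x hx => pow_le_one₀ (hr0 x hx) (hr1 x hx)

theorem norm_oscIntegral_waveDensity_le {p q t : ℝ} (hq : 0 < q) (hqp : q ≤ p) (ht : 1 ≤ |t|)
    (m n : ℕ) :
    ‖oscIntegral (fun x => 4 * x ^ 2) (fun x => waveDensity p q m n x) 0 p t‖
      ≤ 2 * ((p + 20) * (2 / p + 4 * p / p ^ 2)) * |t| ^ (-(1 / 3) : ℝ) := by
  have hp : 0 < p := hq.trans_le hqp
  have hc := continuous_waveDensity_ofReal hp hq m n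
  have hcont : Continuous fun x : ℝ =>
      Complex.exp (-(t * (4 * x ^ 2) : ℝ) * Complex.I) * waveDensity p q m n x := by fun_prop
  have h1 := norm_integral_le_of_forall_Ioo hcont hq
    fun x y hx hxy hy => norm_osc_inner_le hq hqp hx hxy hy ht m n
  have h2 : ‖∫ x in q..p, Complex.exp (-(t * (4 * x ^ 2) : ℝ) * Complex.I) * waveDensity p q m n x‖
      ≤ (p + 20) * |t| ^ (-(1 / 3) : ℝ) * (2 / p + 4 * p / p ^ 2) := by
    rcases hqp.eq_or_lt with h | h
    · rw [h, intervalIntegral.integral_same, norm_zero]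
      positivity
    · exact norm_integral_le_of_forall_Ioo hcont h
        fun x y hx hxy hy => norm_osc_outer_le hq hx hxy hy ht m n
  unfold oscIntegral
  rw [← intervalIntegral.integral_add_adjacent_intervals (hcont.intervalIntegrable 0 q)
    (hcont.intervalIntegrable q p)]
  refine (norm_add_le _ _).trans ?_
  linarith

theorem norm_oscIntegral_waveDensity_le_const {p q : ℝ} (hq : 0 < q) (hqp : q ≤ p) (m n : ℕ)
    (t : ℝ) :
    ‖oscIntegral (fun x => 4 * x ^ 2) (fun x => waveDensity p q m n x) 0 p t‖ ≤ 1 := by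
  have hp : 0 < p := hq.trans_le hqp
  have := intervalIntegral.norm_integral_le_of_norm_le_const (a := 0) (b := p) (C := 1 / p)
    (f := fun x => Complex.exp (-(t * (4 * x ^ 2) : ℝ) * Complex.I) * waveDensity p q m n x)
    (fun x hx => by
      rw [uIoc_of_le hp.le] at hx
      have h1 : ∀ r : ℝ, 0 < r → ‖halfWave r x / r‖ ≤ 1 := fun r hr => by
        rw [norm_div, Complex.norm_real, Real.norm_of_nonneg hr.le, div_le_one hr]
        exact norm_halfWave_le hr.le (by simp)
      rw [← Complex.ofReal_neg, norm_mul, Complex.norm_exp_ofReal_mul_I, one_mul, waveDensity,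
        norm_div, norm_mul, norm_pow, norm_pow]
      refine div_le_div₀ zero_le_one ?_ hp (le_norm_halfWave_add hq hqp hx.1.le hx.2)
      exact mul_le_one₀ (pow_le_one₀ (norm_nonneg _) (h1 p hp)) (by positivity)
        (pow_le_one₀ (norm_nonneg _) (h1 q hq)))
  rwa [sub_zero, abs_of_pos hp, one_div_mul_cancel hp.ne'] at this

theorem norm_couplingIntegral_le {p q : ℝ} (hq : 0 < q) (hqp : q ≤ p) (m n : ℕ) (t : ℝ) :
    ‖couplingIntegral p q m n t‖
      ≤ ‖oscIntegral (fun x => 4 * x ^ 2) (fun x => waveDensity p q m n x) 0 p (-t)‖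
        + ‖oscIntegral (fun x => 4 * x ^ 2) (fun x => waveDensity p q m n x) 0 p t‖ := by
  have hp : 0 < p := hq.trans_le hqp
  have hc := continuous_waveDensity_ofReal hp hq m n
  have hcont : Continuous fun x : ℝ =>
      Complex.exp (-(t * (4 * x ^ 2) : ℝ) * Complex.I) * waveDensity p q m n x := by fun_prop
  unfold couplingIntegral oscIntegral
  rw [max_eq_left hqp, ← intervalIntegral.integral_add_adjacent_intervals
    (hcont.intervalIntegrable (-p) 0) (hcont.intervalIntegrable 0 p)]
  refine (norm_add_le _ _).trans (add_le_add_left (le_of_eq ?_) _)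
  rw [← RCLike.norm_conj (∫ x in (0 : ℝ)..p, _), intervalIntegral.integral_of_le hp.le,
    ← integral_conj, ← intervalIntegral.integral_of_le hp.le]
  have : ∫ x in (-p)..0, Complex.exp (-(t * (4 * x ^ 2) : ℝ) * Complex.I) * waveDensity p q m n x
      = ∫ x in (0 : ℝ)..p, Complex.exp (-(t * (4 * (-x) ^ 2) : ℝ) * Complex.I)
        * waveDensity p q m n (-x : ℝ) := by
    rw [intervalIntegral.integral_comp_neg (fun x : ℝ =>
      Complex.exp (-(t * (4 * x ^ 2) : ℝ) * Complex.I) * waveDensity p q m n x), neg_zero]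
  rw [this]
  congr 2
  ext x
  rw [Complex.ofReal_neg, waveDensity_neg_ofReal, map_mul, ← Complex.exp_conj]
  congr 2
  simp only [map_mul, map_neg, Complex.conj_ofReal, Complex.conj_I, neg_sq]
  push_cast
  ring

theorem exists_couplingIntegral_bound {p q : ℝ} (hp : 0 < p) (hq : 0 < q) :
    ∃ C, ∀ m n t, ‖couplingIntegral p q m n t‖ ≤ C * (|t| + 1) ^ (-(1 / 3) : ℝ) := by
  wlog hqp : q ≤ p generalizing p q
  · obtain ⟨C, hC⟩ := this hq hp (le_of_not_ge hqp)
    exact ⟨C, fun m n t => by rw [couplingIntegral_swap]; exact hC n m t⟩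
  refine ⟨2 * (2 + 2 * (2 * ((p + 20) * (2 / p + 4 * p / p ^ 2)))), fun m n =>
    norm_le_mul_rpow_of_le (fun t => ?_) fun t ht => ?_⟩
  · refine (norm_couplingIntegral_le hq hqp m n t).trans ?_
    linarith [norm_oscIntegral_waveDensity_le_const hq hqp m n t,
      norm_oscIntegral_waveDensity_le_const hq hqp m n (-t)]
  · refine (norm_couplingIntegral_le hq hqp m n t).trans ?_
    have h1 := norm_oscIntegral_waveDensity_le hq hqp ht m n
    have h2 := norm_oscIntegral_waveDensity_le hq hqp (t := -t) (by rwa [abs_neg]) m n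
    rw [abs_neg] at h2
    linarith

theorem theorem1p1 (b₁ b₂ : ℝ) (hb₁ : 0 < b₁) (hb₂ : 0 < b₂) :
    (∀ φ : SeqSpace 2, ∃! U : C(ℝ, SeqSpace 2), IsCoupledSolution b₁ b₂ φ U) ∧
    (∃ C : ℝ, 0 < C ∧
      ∀ (φ : SeqSpace 1) (U : C(ℝ, SeqSpace 2)),
        IsCoupledSolution b₁ b₂ (SeqSpace.incl one_le_two φ) U →
        ∀ t : ℝ, ‖SeqSpace.incl (q := ∞) le_top (U t)‖
          ≤ C * (|t| + 1) ^ (-(1 / 3) : ℝ) * ‖φ‖) := by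
  have hp : 0 < b₁⁻¹ := by positivity
  have hq : 0 < b₂⁻¹ := by positivity
  obtain ⟨C₁, h₁⟩ := exists_couplingIntegral_bound hp hq
  obtain ⟨C₂, h₂⟩ := exists_sineKernel_bound hp
  obtain ⟨C₃, h₃⟩ := exists_sineKernel_bound hq
  have hC : 0 ≤ C₁ + C₂ + C₃ := by
    have e₁ : 0 ≤ C₁ := by simpa using (norm_nonneg _).trans (h₁ 0 0 0)
    have e₂ : 0 ≤ C₂ := by simpa using (norm_nonneg _).trans (h₂ 0 0 0)
    have e₃ : 0 ≤ C₃ := by simpa using (norm_nonneg _).trans (h₃ 0 0 0)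
    positivity
  refine existsUnique_and_decay_of_kernel hb₁ hb₂ ⟨C₁ + C₂ + C₃ + 1, by positivity, fun k => ?_⟩
  obtain ⟨K, hK, hdec⟩ := isKernelColumn_of_decay hp hq h₁ h₂ h₃ k
  rw [inv_pow, inv_pow] at hK
  refine ⟨K, hK, fun t j => (hdec t j).trans ?_⟩
  exact mul_le_mul_of_nonneg_right (by linarith) (by positivity)
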